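/- For a prime $p$, a multiplicative subgroup $\mathcal G$ of $\mathbb F_p^*$ and $\lambda\in\mathbb F_p^*$, let $\mathrm T_\lambda(\mathcal G)$ be the number of $(u_1,v_1,w_1,u_2,v_2,w_2)\in\mathcal G^6$ with $u_1\ne w_1$, $u_2\ne\lambda w_2$ and $$\frac{u_1-v_1}{u_1-w_1}=\frac{u_2-\lambda v_2}{u_2-\lambda w_2}.$$ There is an absolute constant $C>0$ such that for every prime $p$, every multiplicative subgroup $\mathcal G$ of $\mathbb F_p^*$ and every $\lambda\in\mathbb F_p^*$, $$\left|\mathrm T_\lambda(\mathcal G)-\frac{|\mathcal G|^6}{p}\right|\le C\cdot\begin{cases}p^{1/2}|\mathcal G|^{7/2}, & \text{if } |\mathcal G|\ge p^{2/3},\\ |\mathcal G|^5p^{-1/2}, & \text{if } p^{2/3}>|\mathcal G|\ge p^{1/2}\log p,\\ |\mathcal G|^4\log|\mathcal G|, & \text{if } 2\le|\mathcal G|<p^{1/2}\log p.\end{cases}$$ Here $\log$ is the natural logarithm. For small $p$ the first and third conditions can hold simultaneously, and then both bounds are asserted. -/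

import Mathlib

/-- For sets `U₁, U₂ ⊆ F_p^*` and `l₁, l₂ ∈ F_p^*`, the set of all
`((u₁, v₁, w₁), (u₂, v₂, w₂)) ∈ U₁³ × U₂³` with
`(u₁ - l₁ v₁) / (u₁ - l₁ w₁) = (u₂ - l₂ v₂) / (u₂ - l₂ w₂)`,
where only the values of the variables with both denominators nonzero are considered. -/
def collinearTripleSet {p : ℕ} [Fact p.Prime] (l₁ l₂ : (ZMod p)ˣ) (U₁ U₂ : Set (ZMod p)ˣ) :
    Set (((ZMod p)ˣ × (ZMod p)ˣ × (ZMod p)ˣ) × ((ZMod p)ˣ × (ZMod p)ˣ × (ZMod p)ˣ)) :=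
  {s | match s with
    | ((u₁, v₁, w₁), (u₂, v₂, w₂)) =>
      (u₁ ∈ U₁ ∧ v₁ ∈ U₁ ∧ w₁ ∈ U₁) ∧ (u₂ ∈ U₂ ∧ v₂ ∈ U₂ ∧ w₂ ∈ U₂) ∧
      (u₁ : ZMod p) - l₁ * w₁ ≠ 0 ∧ (u₂ : ZMod p) - l₂ * w₂ ≠ 0 ∧
      ((u₁ : ZMod p) - l₁ * v₁) / (u₁ - l₁ * w₁) = ((u₂ : ZMod p) - l₂ * v₂) / (u₂ - l₂ * w₂)}

/-- The number `T_{l₁,l₂}(U₁, U₂)` of collinear triples. -/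
noncomputable def collinearTriples {p : ℕ} [Fact p.Prime] (l₁ l₂ : (ZMod p)ˣ)
    (U₁ U₂ : Set (ZMod p)ˣ) : ℕ :=
  (collinearTripleSet l₁ l₂ U₁ U₂).ncard

/-- `T_l(G) = T_{1,l}(G, G)` for a multiplicative subgroup `G` of `F_p^*`. -/
noncomputable def subgroupCollinearTriples {p : ℕ} [Fact p.Prime] (l : (ZMod p)ˣ)
    (G : Subgroup (ZMod p)ˣ) : ℕ :=
  collinearTriples 1 l (G : Set (ZMod p)ˣ) (G : Set (ZMod p)ˣ)

/-!
Let `n = |G|` and, for units `α, β`, let `N(α, β)` be the number of points of `G × G` on the line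
`α x + β y = 1`. A collinear triple consists of points `(u₁, u₂) ∈ G × G` and
`(v₁, l v₂), (w₁, l w₂) ∈ G × l G` on a line that is not parallel to an axis. The lines through the
origin contribute at most `n ^ 4`, and the others essentially
`∑ N(α, β) N(α, l β) ^ 2`, see `exists_subgroupCollinearTriples_eq`.

Put `m = n ^ 2 / p` and `e = N - m`. Two points determine a line, so the first two moments of `N` are
known, and `∑ e ^ 2 ≤ 4 n ^ 2 p` (`sum_lineError_sq_le`). As `e` is constant on the orbits of
`G × G`, which have `n ^ 2` elements, this already gives `|e| ≤ 2 √p` (`lineError_sq_le`), a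
substitute for the Weil bound. If `p ≤ n ^ 2`, expanding the cubic sum around `m` yields
`n ^ 6 / p + O(n ^ 4 + ∑ |e| ^ 3)` (`abs_subgroupCollinearTriples_sub_le`), where
`∑ |e| ^ 3 ≪ √p · n ^ 2 p`; this settles `n ≥ p ^ (2 / 3)`.

In the remaining ranges it suffices to have an error `O(n ^ 4 log n)`. This follows from the bound
`O(n ^ 2 / τ ^ 3)` for the number of orbits of lines with `N ≥ τ`, valid for `τ` larger than a
constant multiple of `max(1, m)` (`card_rich_lines_mul_le`): summed over `τ` it bounds the part of
`∑ N ^ 3` coming from rich lines by `O(n ^ 4 log n)`, while the poorer lines are controlled by the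
second moment. The bound for rich lines is an instance of Stepanov's method, in the form of
Heath-Brown and Konyagin (`card_mul_pow_three_le`). The points of `G × G` on the line `(α, β)` give
solutions `y` of `y ^ n = α ^ n`, `(1 - y) ^ n = β ^ n`. One constructs a combination of
`X ^ a X ^ (n i) (1 - X) ^ (n j)` that vanishes to high order at all these `y` and compares the number
of zeros with the degree; the combination is not the zero polynomial because a polynomial of degree
less than `p` with `k` terms vanishes at `1` to order less than `k`
(`lt_card_support_of_X_sub_one_pow_dvd`).
-/

/-! ### Multiplicity of sparse polynomials -/

section Stepanov

open Polynomial

/-- A nonzero polynomial of degree less than `p` vanishes at `1` to an order less than the number of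
its terms: the operator `X d/dX - e` removes the term of degree `e` and lowers the order by at most
one. -/
theorem lt_card_support_of_X_sub_one_pow_dvd {p : ℕ} [Fact p.Prime] (m : ℕ) :
    ∀ f : (ZMod p)[X], f ≠ 0 → f.natDegree < p → (X - C 1) ^ m ∣ f → m < f.support.card := by
  induction m with
  | zero =>
    intro f hf _ _
    exact Finset.card_pos.2 (nonempty_support_iff.2 hf)
  | succ m ih =>
    intro f hf hdeg hdvd
    set e := f.natDegree with he
    set g : (ZMod p)[X] := X * derivative f - C (e : ZMod p) * f with hg
    have hcoeff : ∀ i, g.coeff i = ((i : ZMod p) - e) * f.coeff i := by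
      intro i
      rw [hg, coeff_sub, coeff_C_mul]
      cases i with
      | zero => simp
      | succ i => rw [coeff_X_mul, coeff_derivative]; push_cast; ring
    have hsupp : g.support = f.support.erase e := by
      ext i
      simp only [mem_support_iff, Finset.mem_erase, hcoeff, mul_ne_zero_iff]
      constructor
      · rintro ⟨h1, h2⟩
        exact ⟨fun h => h1 (by rw [h, sub_self]), h2⟩
      · rintro ⟨h1, h2⟩
        refine ⟨fun h => h1 ?_, h2⟩
        have hi : i < p := lt_of_le_of_lt (le_natDegree_of_ne_zero h2) hdeg
        have := (ZMod.natCast_eq_natCast_iff' i e p).1 (sub_eq_zero.1 h)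
        rwa [Nat.mod_eq_of_lt hi, Nat.mod_eq_of_lt hdeg] at this
    have hmem : e ∈ f.support := natDegree_mem_support_of_nonzero hf
    have hcard : g.support.card + 1 = f.support.card := by
      rw [hsupp, Finset.card_erase_add_one hmem]
    have hroot : f.eval 1 = 0 := by
      have : (X - C 1) ∣ f := (dvd_pow_self _ (Nat.succ_ne_zero m)).trans hdvd
      exact dvd_iff_isRoot.1 this
    have hg0 : g ≠ 0 := by
      intro h0
      -- otherwise `f` is a monomial, which does not vanish at `1`
      have h1 : f.support.card = 1 := by rw [← hcard, h0]; simp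
      obtain ⟨k, x, hx, hfx⟩ := card_support_eq_one.1 h1
      rw [hfx] at hroot
      simp at hroot
      exact hx hroot
    have hgdeg : g.natDegree < p := by
      refine lt_of_le_of_lt ?_ hdeg
      refine natDegree_le_iff_coeff_eq_zero.2 fun i hi => ?_
      rw [hcoeff, coeff_eq_zero_of_natDegree_lt hi, mul_zero]
    have hgdvd : (X - C 1) ^ m ∣ g := by
      refine dvd_sub (Dvd.dvd.mul_left ?_ _) (Dvd.dvd.mul_left ((pow_dvd_pow _ m.le_succ).trans hdvd) _)
      obtain ⟨r, hr⟩ := hdvd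
      rw [hr, derivative_mul, derivative_pow]
      refine dvd_add (Dvd.dvd.mul_right ?_ _) (Dvd.dvd.mul_right (pow_dvd_pow _ m.le_succ) _)
      refine Dvd.dvd.mul_right (Dvd.dvd.mul_left ?_ _) _
      simp
    have := ih g hg0 hgdeg hgdvd
    omega

/-! ### Stepanov's method -/

/-- The derivation `X (1 - X) d/dX`. -/
noncomputable def twistedDerivative (p : ℕ) [Fact p.Prime] : (ZMod p)[X] →ₗ[ZMod p] (ZMod p)[X] :=
  LinearMap.mulLeft (ZMod p) (X * (1 - X)) ∘ₗ derivative

theorem twistedDerivative_apply {p : ℕ} [Fact p.Prime] (f : (ZMod p)[X]) :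
    twistedDerivative p f = X * (1 - X) * derivative f := rfl

/-- Away from the zeros of `X (1 - X)`, this derivation detects multiplicities up to `p`. -/
theorem X_sub_C_pow_dvd_of_twistedDerivative {p : ℕ} [Fact p.Prime] {x : ZMod p} (hx0 : x ≠ 0)
    (hx1 : x ≠ 1) (k : ℕ) : ∀ f : (ZMod p)[X], k ≤ p →
      (∀ i < k, ((twistedDerivative p ^ i) f).eval x = 0) → (X - C x) ^ k ∣ f := by
  induction k with
  | zero => intro f _ _; simp
  | succ k ih =>
    intro f hk h
    by_cases hf : f = 0
    · simp [hf]
    have hroot : f.eval x = 0 := by simpa using h 0 (Nat.succ_pos k)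
    have h1 : (X - C x) ^ k ∣ X * (1 - X) * derivative f := by
      rw [← twistedDerivative_apply]
      refine ih _ (by omega) fun i hi => ?_
      have := h (i + 1) (by omega)
      rwa [pow_succ] at this
    have hprime : Prime (X - C x) := prime_X_sub_C x
    have h2 : (X - C x) ^ k ∣ derivative f := by
      refine hprime.pow_dvd_of_dvd_mul_left k ?_ h1
      rw [dvd_iff_isRoot]
      simp only [IsRoot, eval_mul, eval_sub, eval_X, eval_one]
      exact mul_ne_zero hx0 (sub_ne_zero.2 (Ne.symm hx1))
    rw [← le_rootMultiplicity_iff hf]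
    by_contra hlt
    have hm : f.rootMultiplicity x < k + 1 := by omega
    have hpos : 0 < f.rootMultiplicity x := (rootMultiplicity_pos hf).2 hroot
    have hne : ((f.rootMultiplicity x : ℕ) : ZMod p) ≠ 0 := by
      intro h0
      rw [ZMod.natCast_eq_zero_iff] at h0
      have := Nat.le_of_dvd hpos h0
      omega
    have h3 := derivative_rootMultiplicity_of_root_of_mem_nonZeroDivisors (p := f) (t := x) hroot
      (mem_nonZeroDivisors_of_ne_zero hne)
    have hd0 : derivative f ≠ 0 := by
      intro h0
      obtain ⟨g, hg, hgx⟩ := exists_eq_pow_rootMultiplicity_mul_and_not_dvd f hf x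
      set r := f.rootMultiplicity x
      have h5 : (X - C x) ^ (r - 1) * (C (r : ZMod p) * g + (X - C x) * derivative g) = 0 := by
        rw [← h0]
        conv_rhs => rw [hg]
        rw [derivative_mul, derivative_X_sub_C_pow]
        obtain ⟨s, hs⟩ : ∃ s, r = s + 1 := ⟨r - 1, by omega⟩
        rw [hs]
        simp only [Nat.add_sub_cancel, map_natCast]
        ring
      have h6 := (mul_eq_zero.1 h5).resolve_left (pow_ne_zero _ (X_sub_C_ne_zero x))
      have h7 := congrArg (eval x) h6
      simp only [eval_add, eval_mul, eval_C, eval_sub, eval_X, sub_self, zero_mul, add_zero,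
        eval_zero] at h7
      exact hgx (dvd_iff_isRoot.2 ((mul_eq_zero.1 h7).resolve_left hne))
    have h4 := (le_rootMultiplicity_iff hd0).2 h2
    omega

/-- The polynomial factors `P k` in the identity
`(X (1 - X) d/dX)^k (X ^ a * (X ^ u * (1 - X) ^ v)) = P k * (X ^ u * (1 - X) ^ v)`. -/
noncomputable def twistedFactor (p a u v : ℕ) : ℕ → (ZMod p)[X]
  | 0 => X ^ a
  | k + 1 => X * (1 - X) * derivative (twistedFactor p a u v k) +
      ((u : (ZMod p)[X]) * (1 - X) - (v : (ZMod p)[X]) * X) * twistedFactor p a u v k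

theorem natDegree_twistedFactor_le {p : ℕ} [Fact p.Prime] (a u v k : ℕ) :
    (twistedFactor p a u v k).natDegree ≤ a + k := by
  induction k with
  | zero => simp [twistedFactor]
  | succ k ih =>
    have h1 : (1 - X : (ZMod p)[X]).natDegree ≤ 1 := by
      refine (natDegree_sub_le _ _).trans ?_
      simp
    rw [twistedFactor]
    refine natDegree_add_le_of_degree_le ?_ ?_
    · by_cases h0 : (twistedFactor p a u v k).natDegree = 0
      · rw [natDegree_eq_zero] at h0
        obtain ⟨c, hc⟩ := h0
        rw [← hc]; simp
      · have h2 : (derivative (twistedFactor p a u v k)).natDegree ≤ a + k - 1 :=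
          (natDegree_derivative_le _).trans (by omega)
        have h3 : (X * (1 - X) : (ZMod p)[X]).natDegree ≤ 2 :=
          natDegree_mul_le_of_le natDegree_X_le h1
        refine (natDegree_mul_le_of_le h3 h2).trans ?_
        omega
    · have h4 : ((u : (ZMod p)[X]) * (1 - X) - (v : (ZMod p)[X]) * X).natDegree ≤ 1 := by
        refine (natDegree_sub_le_of_le (m := 1) (n := 1) ?_ ?_).trans (by simp)
        · exact (natDegree_mul_le_of_le (natDegree_natCast u).le h1).trans (by simp)
        · exact (natDegree_mul_le_of_le (natDegree_natCast v).le natDegree_X_le).trans (by simp)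
      refine (natDegree_mul_le_of_le h4 ih).trans ?_
      omega

theorem twistedDerivative_pow_apply {p : ℕ} [Fact p.Prime] (a u v k : ℕ) :
    (twistedDerivative p ^ k) (X ^ a * (X ^ u * (1 - X) ^ v)) =
      twistedFactor p a u v k * (X ^ u * (1 - X) ^ v) := by
  induction k with
  | zero => simp [twistedFactor]
  | succ k ih =>
    have hu : ∀ m : ℕ, (X : (ZMod p)[X]) * derivative (X ^ m : (ZMod p)[X]) =
        (m : (ZMod p)[X]) * X ^ m := by
      intro m
      cases m with
      | zero => simp
      | succ m => rw [derivative_X_pow]; simp; ring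
    have hv : ∀ m : ℕ, (1 - X : (ZMod p)[X]) * derivative ((1 - X) ^ m : (ZMod p)[X]) =
        - ((m : (ZMod p)[X]) * (1 - X) ^ m) := by
      intro m
      cases m with
      | zero => simp
      | succ m => rw [derivative_pow]; simp; ring
    rw [pow_succ', Module.End.mul_apply, ih, twistedDerivative_apply, twistedFactor,
      derivative_mul, derivative_mul]
    linear_combination (twistedFactor p a u v k * (1 - X) * (1 - X) ^ v) * hu u +
      (twistedFactor p a u v k * X * X ^ u) * hv v

theorem eq_zero_of_sum_pow_mul_eq_zero {R : Type*} [CommRing R] [IsDomain R] {q : R} (hq : q ≠ 0) :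
    ∀ (B : ℕ) (f : Fin B → R), (∀ b, q ∣ f b → f b = 0) → ∑ b : Fin B, q ^ (b : ℕ) * f b = 0 →
      ∀ b, f b = 0 := by
  intro B
  induction B with
  | zero => intro f _ _ b; exact b.elim0
  | succ B ih =>
    intro f hf hsum
    rw [Fin.sum_univ_succ] at hsum
    have hs : ∑ b : Fin B, q ^ ((b.succ : Fin (B + 1)) : ℕ) * f b.succ =
        q * ∑ b : Fin B, q ^ (b : ℕ) * f b.succ := by
      rw [Finset.mul_sum]
      refine Finset.sum_congr rfl fun b _ => ?_
      rw [Fin.val_succ, pow_succ']; ring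
    rw [hs] at hsum
    simp only [Fin.val_zero, pow_zero, one_mul] at hsum
    have h0 : f 0 = 0 := by
      refine hf 0 ⟨- ∑ b : Fin B, q ^ (b : ℕ) * f b.succ, ?_⟩
      linear_combination hsum
    rw [h0, zero_add] at hsum
    have := ih (fun b => f b.succ) (fun b => hf _) ((mul_eq_zero.1 hsum).resolve_left hq)
    intro b
    refine Fin.cases h0 this b

/-- The auxiliary polynomial `∑ c(a,i,j) X ^ a * X ^ (n i) * (1 - X) ^ (n j)` of Stepanov's
method. -/
noncomputable def stepanovPoly (p n : ℕ) {A B : ℕ} (c : Fin A × Fin B × Fin B → ZMod p) :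
    (ZMod p)[X] :=
  ∑ i, c i • (X ^ (i.1 : ℕ) * (X ^ (n * (i.2.1 : ℕ)) * (1 - X) ^ (n * (i.2.2 : ℕ))))

/-- Grouping by powers of `(1 - X) ^ n`, the first nonzero group would be a polynomial with at most
`A B ≤ n` terms that is divisible by `(1 - X) ^ n`. -/
theorem stepanovPoly_ne_zero {p : ℕ} [Fact p.Prime] {n A B : ℕ} (hAB : A * B ≤ n)
    (hnB : n * B ≤ p) {c : Fin A × Fin B × Fin B → ZMod p} (hc : c ≠ 0) :
    stepanovPoly p n c ≠ 0 := by
  intro hzero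
  apply hc
  set f : Fin B → (ZMod p)[X] := fun j => ∑ i : Fin A × Fin B,
    monomial ((i.1 : ℕ) + n * (i.2 : ℕ)) (c (i.1, i.2, j)) with hf
  have hsum : ∑ j : Fin B, ((1 - X : (ZMod p)[X]) ^ n) ^ (j : ℕ) * f j = 0 := by
    rw [← hzero, stepanovPoly, Fintype.sum_prod_type]
    simp only [Fintype.sum_prod_type, hf, Finset.mul_sum]
    rw [Finset.sum_comm]
    refine Finset.sum_congr rfl fun a _ => ?_
    rw [Finset.sum_comm]
    refine Finset.sum_congr rfl fun i _ => Finset.sum_congr rfl fun j _ => ?_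
    rw [← C_mul_X_pow_eq_monomial, smul_eq_C_mul]
    ring
  have hinj : Function.Injective fun i : Fin A × Fin B => (i.1 : ℕ) + n * (i.2 : ℕ) := by
    rintro ⟨a, i⟩ ⟨a', i'⟩ h
    simp only at h
    have hB : 1 ≤ B := by have := i.2; omega
    have hA : A ≤ n := le_trans (Nat.le_mul_of_pos_right A hB) hAB
    have ha : (a : ℕ) < n := lt_of_lt_of_le a.2 hA
    have ha' : (a' : ℕ) < n := lt_of_lt_of_le a'.2 hA
    have h1 : (a : ℕ) = a' := by
      have := congrArg (· % n) h
      simpa [Nat.add_mul_mod_self_left, Nat.mod_eq_of_lt ha, Nat.mod_eq_of_lt ha'] using this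
    have h2 : (i : ℕ) = i' := by
      rw [h1] at h
      exact Nat.eq_of_mul_eq_mul_left (by omega) (Nat.add_left_cancel h)
    exact Prod.ext (Fin.ext h1) (Fin.ext h2)
  have hcoeff : ∀ j (i : Fin A × Fin B),
      (f j).coeff ((i.1 : ℕ) + n * (i.2 : ℕ)) = c (i.1, i.2, j) := by
    intro j i
    simp only [hf, finsetSum_coeff, coeff_monomial]
    rw [Finset.sum_eq_single i]
    · simp
    · intro b _ hb
      exact if_neg fun h => hb (hinj h)
    · simp
  have hsupp : ∀ j, (f j).support ⊆
      Finset.univ.image fun i : Fin A × Fin B => (i.1 : ℕ) + n * (i.2 : ℕ) := by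
    intro j m hm
    by_contra hcon
    simp only [Finset.mem_image, Finset.mem_univ, true_and, not_exists] at hcon
    refine mem_support_iff.1 hm ?_
    simp only [hf, finsetSum_coeff, coeff_monomial]
    exact Finset.sum_eq_zero fun i _ => if_neg (hcon i)
  have hq : ((1 - X : (ZMod p)[X]) ^ n) ≠ 0 := by
    refine pow_ne_zero _ fun h => ?_
    have := congrArg (eval 0) h
    simp at this
  have key := eq_zero_of_sum_pow_mul_eq_zero hq B f ?_ hsum
  · funext i
    have := hcoeff i.2.2 (i.1, i.2.1)
    rw [key] at this
    simpa using this.symm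
  · intro j hdvd
    by_contra hne
    have hdvd' : (X - C 1 : (ZMod p)[X]) ^ n ∣ f j := by
      refine dvd_trans ?_ hdvd
      refine pow_dvd_pow_of_dvd ⟨-1, ?_⟩ n
      rw [C_1]; ring
    have hdeg : (f j).natDegree < p := by
      have := hsupp j (natDegree_mem_support_of_nonzero hne)
      simp only [Finset.mem_image, Finset.mem_univ, true_and] at this
      obtain ⟨⟨a, i⟩, h⟩ := this
      rw [← h]
      simp only
      have hi : (i : ℕ) + 1 ≤ B := i.2
      have hA : A ≤ n := le_trans (Nat.le_mul_of_pos_right A (by omega)) hAB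
      have ha := a.2
      have : n * (i + 1) ≤ n * B := Nat.mul_le_mul_left n hi
      rw [mul_add, mul_one] at this
      omega
    have h1 := lt_card_support_of_X_sub_one_pow_dvd n (f j) hne hdeg hdvd'
    have h2 := Finset.card_le_card (hsupp j)
    have h3 : (Finset.univ.image fun i : Fin A × Fin B => (i.1 : ℕ) + n * (i.2 : ℕ)).card ≤
        A * B := by
      refine Finset.card_image_le.trans ?_
      simp
    omega

theorem natDegree_stepanovPoly_le {p : ℕ} [Fact p.Prime] {n A B : ℕ} (hA : A ≤ n)
    (c : Fin A × Fin B × Fin B → ZMod p) : (stepanovPoly p n c).natDegree ≤ 2 * (n * B) := by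
  refine natDegree_sum_le_of_forall_le _ _ fun i _ => ?_
  refine (natDegree_smul_le _ _).trans ?_
  have h1 : (1 - X : (ZMod p)[X]).natDegree ≤ 1 := (natDegree_sub_le _ _).trans (by simp)
  have h2 : ((1 - X : (ZMod p)[X]) ^ (n * (i.2.2 : ℕ))).natDegree ≤ n * (i.2.2 : ℕ) :=
    (natDegree_pow_le_of_le _ h1).trans (by simp)
  refine (natDegree_mul_le_of_le (natDegree_X_pow_le _)
    (natDegree_mul_le_of_le (natDegree_X_pow_le _) h2)).trans ?_
  have h3 : n * ((i.2.1 : ℕ) + 1) ≤ n * B := Nat.mul_le_mul_left n i.2.1.2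
  have h4 : n * ((i.2.2 : ℕ) + 1) ≤ n * B := Nat.mul_le_mul_left n i.2.2.2
  have h5 := i.1.2
  rw [mul_add, mul_one] at h3 h4
  omega

/-- A nontrivial choice of coefficients makes the auxiliary polynomial vanish to order `A` at all
points `y` with `(y ^ n, (1 - y) ^ n)` in a prescribed set: as `y ^ n` and `(1 - y) ^ n` are
constant on each fibre, the derivatives become polynomials in `y` of degree less than `2 A`, so
that the vanishing costs at most `2 A ^ 2` linear conditions per fibre. -/
theorem exists_stepanovPoly {p : ℕ} [Fact p.Prime] {n A B : ℕ} (hn : n ≠ 0) (hA : A ≤ p)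
    (V : Finset (ZMod p × ZMod p)) (hV : ∀ v ∈ V, v.1 ≠ 0 ∧ v.2 ≠ 0) (hA0 : 0 < A)
    (hcount : 2 * V.card * A < B ^ 2) :
    ∃ c : Fin A × Fin B × Fin B → ZMod p, c ≠ 0 ∧
      ∀ y : ZMod p, (y ^ n, (1 - y) ^ n) ∈ V → (X - C y) ^ A ∣ stepanovPoly p n c := by
  classical
  let M : Matrix (V × Fin A × Fin (A + A)) (Fin A × Fin B × Fin B) (ZMod p) :=
    fun r i => r.1.1.1 ^ (i.2.1 : ℕ) * r.1.1.2 ^ (i.2.2 : ℕ) *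
      (twistedFactor p i.1 (n * (i.2.1 : ℕ)) (n * (i.2.2 : ℕ)) r.2.1).coeff r.2.2
  have hker : LinearMap.ker M.mulVecLin ≠ ⊥ := by
    refine LinearMap.ker_ne_bot_of_finrank_lt ?_
    simp only [Module.finrank_fintype_fun_eq_card, Fintype.card_prod, Fintype.card_fin,
      Fintype.card_coe]
    calc V.card * (A * (A + A)) = A * (2 * V.card * A) := by ring
      _ < A * B ^ 2 := Nat.mul_lt_mul_of_pos_left hcount hA0
      _ = A * (B * B) := by ring
  obtain ⟨c, hc, hc0⟩ := Submodule.exists_mem_ne_zero_of_ne_bot hker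
  refine ⟨c, hc0, fun y hy => ?_⟩
  have hne := hV _ hy
  have hy0 : y ≠ 0 := fun h => hne.1 (by simp [h, hn])
  have hy1 : y ≠ 1 := fun h => hne.2 (by simp [h, hn])
  refine X_sub_C_pow_dvd_of_twistedDerivative hy0 hy1 A _ hA fun k hk => ?_
  have hrow : ∀ m : Fin (A + A), ∑ i, M (⟨_, hy⟩, ⟨k, hk⟩, m) i * c i = 0 := by
    intro m
    have := congrFun (LinearMap.mem_ker.1 hc) (⟨_, hy⟩, ⟨k, hk⟩, m)
    simpa [Matrix.mulVecLin_apply, Matrix.mulVec, dotProduct] using this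
  have heval : ∀ i : Fin A × Fin B × Fin B,
      (twistedFactor p i.1 (n * (i.2.1 : ℕ)) (n * (i.2.2 : ℕ)) k).eval y =
        ∑ m : Fin (A + A),
          (twistedFactor p i.1 (n * (i.2.1 : ℕ)) (n * (i.2.2 : ℕ)) k).coeff m * y ^ (m : ℕ) := by
    intro i
    rw [eval_eq_sum_range' (n := A + A), Finset.sum_range]
    have := natDegree_twistedFactor_le (p := p) i.1 (n * (i.2.1 : ℕ)) (n * (i.2.2 : ℕ)) k
    have := i.1.2
    omega
  rw [stepanovPoly, map_sum, eval_finsetSum]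
  simp only [map_smul, twistedDerivative_pow_apply, eval_smul, eval_mul, eval_pow, eval_sub,
    eval_X, eval_one, heval, smul_eq_mul]
  calc _ = ∑ m : Fin (A + A), y ^ (m : ℕ) * ∑ i, M (⟨_, hy⟩, ⟨k, hk⟩, m) i * c i := by
        simp only [Finset.mul_sum, Finset.sum_mul]
        rw [Finset.sum_comm]
        refine Finset.sum_congr rfl fun m _ => Finset.sum_congr rfl fun i _ => ?_
        simp only [M]
        rw [← pow_mul, ← pow_mul]
        ring
    _ = 0 := by simp [hrow]

/-- The number of zeros of the auxiliary polynomial, with multiplicity, is at most its degree. -/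
theorem stepanov_inequality {p : ℕ} [Fact p.Prime] {n A B τ : ℕ} (hA0 : 0 < A) (hB0 : 0 < B)
    (hAB : A * B ≤ n) (hnB : n * B ≤ p) (V : Finset (ZMod p × ZMod p))
    (hV : ∀ v ∈ V, v.1 ≠ 0 ∧ v.2 ≠ 0) (hcount : 2 * V.card * A < B ^ 2)
    (hτ : ∀ v ∈ V, τ ≤ (Finset.univ.filter fun y : ZMod p => (y ^ n, (1 - y) ^ n) = v).card) :
    V.card * τ * A ≤ 2 * (n * B) := by
  classical
  have hAn : A ≤ n := le_trans (Nat.le_mul_of_pos_right A hB0) hAB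
  have hnp : n ≤ p := le_trans (Nat.le_mul_of_pos_right n hB0) hnB
  obtain ⟨c, hc0, hc⟩ := exists_stepanovPoly (n := n) (by omega) (hAn.trans hnp) V hV hA0 hcount
  set S := Finset.univ.filter fun y : ZMod p => (y ^ n, (1 - y) ^ n) ∈ V with hS
  have hcard : V.card * τ ≤ S.card := by
    have hmaps : Set.MapsTo (fun y : ZMod p => (y ^ n, (1 - y) ^ n)) S V :=
      fun y hy => (Finset.mem_filter.1 hy).2
    rw [Finset.card_eq_sum_card_fiberwise hmaps, ← smul_eq_mul]
    refine Finset.card_nsmul_le_sum _ _ _ fun v hv => (hτ v hv).trans (Finset.card_le_card ?_)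
    intro y hy
    simp only [Finset.mem_filter, Finset.mem_univ, true_and, hS] at hy ⊢
    exact ⟨hy ▸ hv, hy⟩
  have hdvd : ∏ y ∈ S, (X - C y) ^ A ∣ stepanovPoly p n c := by
    refine Finset.prod_dvd_of_coprime ?_ fun y hy => hc y (Finset.mem_filter.1 hy).2
    intro y _ z _ hyz
    exact (pairwise_coprime_X_sub_C Function.injective_id hyz).pow
  have hdeg := (natDegree_le_of_dvd hdvd (stepanovPoly_ne_zero hAB hnB hc0)).trans
    (natDegree_stepanovPoly_le hAn c)
  rw [natDegree_prod_of_monic _ _ fun y _ => (monic_X_sub_C y).pow A] at hdeg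
  simp only [natDegree_pow, natDegree_X_sub_C, mul_one, Finset.sum_const, smul_eq_mul] at hdeg
  exact (Nat.mul_le_mul_right A hcard).trans hdeg

/-- Stepanov's method: if each of the `h` pairs in `V` is the value of `(y ^ n, (1 - y) ^ n)` for at
least `τ` points `y`, then `h τ ^ 3 ≪ n ^ 2`, for `h` not too large. -/
theorem card_mul_pow_three_le {p : ℕ} [Fact p.Prime] {n τ : ℕ} (V : Finset (ZMod p × ZMod p))
    (hV : ∀ v ∈ V, v.1 ≠ 0 ∧ v.2 ≠ 0) (hn : 8 * V.card < n ^ 2)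
    (hp : 64 * V.card * n ^ 4 ≤ p ^ 3)
    (hτ : ∀ v ∈ V, τ ≤ (Finset.univ.filter fun y : ZMod p => (y ^ n, (1 - y) ^ n) = v).card) :
    V.card * τ ^ 3 ≤ 2 ^ 15 * n ^ 2 := by
  set h := V.card with hh
  rcases Nat.eq_zero_or_pos h with h0 | hpos
  · rw [h0]; simp
  have hn0 : 0 < n := by
    rcases Nat.eq_zero_or_pos n with h0 | h0
    · rw [h0] at hn; simp at hn
    · exact h0
  -- `A` is the largest integer with `8 h A ^ 3 < n ^ 2`
  obtain ⟨A, hA, hA'⟩ : ∃ A, 8 * h * A ^ 3 < n ^ 2 ∧ n ^ 2 ≤ 8 * h * (A + 1) ^ 3 := by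
    have hex : ∃ a, n ^ 2 ≤ 8 * h * (a + 1) ^ 3 := by
      refine ⟨n ^ 2, ?_⟩
      calc n ^ 2 ≤ n ^ 2 + 1 := Nat.le_succ _
        _ ≤ (n ^ 2 + 1) ^ 3 := Nat.le_self_pow (by norm_num) _
        _ ≤ 8 * h * (n ^ 2 + 1) ^ 3 := Nat.le_mul_of_pos_left _ (by omega)
    classical
    refine ⟨Nat.find hex, ?_, Nat.find_spec hex⟩
    rcases Nat.eq_zero_or_pos (Nat.find hex) with h0 | h0
    · rw [h0]; simp; omega
    · have := Nat.find_min hex (Nat.sub_lt h0 one_pos)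
      rw [Nat.sub_add_cancel (by exact h0)] at this
      omega
  have hA0 : 0 < A := by
    rcases Nat.eq_zero_or_pos A with h0 | h0
    · rw [h0] at hA'; simp at hA'; omega
    · exact h0
  have hA64 : n ^ 2 ≤ 64 * (h * A ^ 3) := by
    have : (A + 1) ^ 3 ≤ (2 * A) ^ 3 := Nat.pow_le_pow_left (by omega) 3
    calc n ^ 2 ≤ 8 * h * (A + 1) ^ 3 := hA'
      _ ≤ 8 * h * (2 * A) ^ 3 := Nat.mul_le_mul_left _ this
      _ = 64 * (h * A ^ 3) := by ring
  have hAn : A ≤ n := by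
    by_contra hlt
    have h1 : n ^ 3 ≤ A ^ 3 := Nat.pow_le_pow_left (by omega) 3
    have h2 : n ^ 2 ≤ n ^ 3 := Nat.pow_le_pow_right hn0 (by norm_num)
    have h3 : A ^ 3 ≤ 8 * h * A ^ 3 := Nat.le_mul_of_pos_left _ (by omega)
    omega
  set B := n / A with hB
  have hB0 : 0 < B := Nat.div_pos hAn hA0
  have hAB : A * B ≤ n := Nat.mul_div_le n A
  have hAB' : n ≤ 2 * (A * B) := by
    have h1 : n < A * (B + 1) := Nat.lt_mul_div_succ n hA0
    have h2 : A ≤ A * B := Nat.le_mul_of_pos_right A hB0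
    rw [mul_add, mul_one] at h1
    omega
  have hpA : n ^ 2 ≤ p * A := by
    have h1 : (n ^ 2) ^ 3 ≤ (p * A) ^ 3 := by
      calc (n ^ 2) ^ 3 = n ^ 4 * n ^ 2 := by ring
        _ ≤ n ^ 4 * (64 * (h * A ^ 3)) := Nat.mul_le_mul_left _ hA64
        _ = (64 * h * n ^ 4) * A ^ 3 := by ring
        _ ≤ p ^ 3 * A ^ 3 := Nat.mul_le_mul_right _ hp
        _ = (p * A) ^ 3 := by ring
    exact (Nat.pow_le_pow_iff_left (by norm_num)).1 h1
  have hnB : n * B ≤ p := by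
    refine Nat.le_of_mul_le_mul_right ?_ hA0
    calc n * B * A = n * (A * B) := by ring
      _ ≤ n * n := Nat.mul_le_mul_left _ hAB
      _ = n ^ 2 := by ring
      _ ≤ p * A := hpA
  have hcount : 2 * h * A < B ^ 2 := by
    have hA2 : 0 < 4 * A ^ 2 := by positivity
    refine Nat.lt_of_mul_lt_mul_left (a := 4 * A ^ 2) ?_
    calc 4 * A ^ 2 * (2 * h * A) = 8 * h * A ^ 3 := by ring
      _ < n ^ 2 := hA
      _ ≤ (2 * (A * B)) ^ 2 := Nat.pow_le_pow_left hAB' 2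
      _ = 4 * A ^ 2 * B ^ 2 := by ring
  have hmain := stepanov_inequality hA0 hB0 hAB hnB V hV hcount hτ
  rw [← hh] at hmain
  have h2 : h * τ * A ^ 2 ≤ 2 * n ^ 2 := by
    calc h * τ * A ^ 2 = h * τ * A * A := by ring
      _ ≤ 2 * (n * B) * A := Nat.mul_le_mul_right _ hmain
      _ = 2 * (n * (A * B)) := by ring
      _ ≤ 2 * (n * n) := Nat.mul_le_mul_left _ (Nat.mul_le_mul_left _ hAB)
      _ = 2 * n ^ 2 := by ring
  refine Nat.le_of_mul_le_mul_right (c := n ^ 4) ?_ (by positivity)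
  calc h * τ ^ 3 * n ^ 4 = h * τ ^ 3 * (n ^ 2) ^ 2 := by ring
    _ ≤ h * τ ^ 3 * (64 * (h * A ^ 3)) ^ 2 :=
        Nat.mul_le_mul_left _ (Nat.pow_le_pow_left hA64 2)
    _ = 2 ^ 12 * (h * τ * A ^ 2) ^ 3 := by ring
    _ ≤ 2 ^ 12 * (2 * n ^ 2) ^ 3 := Nat.mul_le_mul_left _ (Nat.pow_le_pow_left h2 3)
    _ = 2 ^ 15 * n ^ 2 * n ^ 4 := by ring

end Stepanov

section Lines

variable {p : ℕ} [Fact p.Prime]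

/-! ### Points on lines -/

open Classical in
/-- The elements of a subgroup of `(ZMod p)ˣ` as a finset. -/
noncomputable def subgroupFinset (G : Subgroup (ZMod p)ˣ) : Finset (ZMod p)ˣ :=
  Finset.univ.filter (· ∈ G)

theorem mem_subgroupFinset {G : Subgroup (ZMod p)ˣ} {x : (ZMod p)ˣ} :
    x ∈ subgroupFinset G ↔ x ∈ G := by
  simp [subgroupFinset]

theorem card_subgroupFinset (G : Subgroup (ZMod p)ˣ) : (subgroupFinset G).card = Nat.card G := by
  classical
  rw [Nat.card_eq_fintype_card, Fintype.card_subtype, subgroupFinset]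

open Classical in
/-- The points of `G × G` on the line `α x + β y = 1`, where `q = (α, β)`. -/
noncomputable def linePoints (G : Subgroup (ZMod p)ˣ) (q : (ZMod p)ˣ × (ZMod p)ˣ) :
    Finset ((ZMod p)ˣ × (ZMod p)ˣ) :=
  (subgroupFinset G ×ˢ subgroupFinset G).filter
    fun x => (q.1 : ZMod p) * x.1 + (q.2 : ZMod p) * x.2 = 1

theorem mem_linePoints {G : Subgroup (ZMod p)ˣ} {q x : (ZMod p)ˣ × (ZMod p)ˣ} :
    x ∈ linePoints G q ↔
      (x.1 ∈ G ∧ x.2 ∈ G) ∧ (q.1 : ZMod p) * x.1 + (q.2 : ZMod p) * x.2 = 1 := by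
  simp [linePoints, mem_subgroupFinset]

/-- The dilation `(α, β) ↦ (α, l β)` of the set of lines. The points `(x, y)` of `G × G` on the
image line correspond to the points `(x, l y)` of `G × l G` on the original line. -/
def lineShift (l : (ZMod p)ˣ) : Equiv.Perm ((ZMod p)ˣ × (ZMod p)ˣ) :=
  Equiv.prodCongr (Equiv.refl _) (Equiv.mulRight l)

theorem lineShift_apply (l : (ZMod p)ˣ) (q : (ZMod p)ˣ × (ZMod p)ˣ) :
    lineShift l q = (q.1, q.2 * l) := rfl

open Classical in
/-- The pairs `P ∈ G × G`, `R ∈ G × l G` of distinct points on the line `q`; the point `R = (x, l y)`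
is recorded as `(x, y)`. -/
noncomputable def linePairs (G : Subgroup (ZMod p)ˣ) (l : (ZMod p)ˣ)
    (q : (ZMod p)ˣ × (ZMod p)ˣ) :
    Finset (((ZMod p)ˣ × (ZMod p)ˣ) × ((ZMod p)ˣ × (ZMod p)ˣ)) :=
  (linePoints G q ×ˢ linePoints G (lineShift l q)).filter fun x => x.1.1 ≠ x.2.1

theorem mem_linePairs {G : Subgroup (ZMod p)ˣ} {l : (ZMod p)ˣ} {q : (ZMod p)ˣ × (ZMod p)ˣ}
    {x : ((ZMod p)ˣ × (ZMod p)ˣ) × ((ZMod p)ˣ × (ZMod p)ˣ)} :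
    x ∈ linePairs G l q ↔
      (x.1 ∈ linePoints G q ∧ x.2 ∈ linePoints G (lineShift l q)) ∧ x.1.1 ≠ x.2.1 := by
  simp [linePairs]

theorem card_linePairs_le (G : Subgroup (ZMod p)ˣ) (l : (ZMod p)ˣ) (q : (ZMod p)ˣ × (ZMod p)ˣ) :
    (linePairs G l q).card ≤ (linePoints G q).card * (linePoints G (lineShift l q)).card := by
  rw [← Finset.card_product]
  exact Finset.card_filter_le _ _

/-- The omitted pairs have equal first coordinates, and then the first point determines the second. -/
theorem mul_card_le_card_linePairs_add (G : Subgroup (ZMod p)ˣ) (l : (ZMod p)ˣ)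
    (q : (ZMod p)ˣ × (ZMod p)ˣ) :
    (linePoints G q).card * (linePoints G (lineShift l q)).card ≤
      (linePairs G l q).card + (linePoints G q).card := by
  classical
  rw [← Finset.card_product, ← Finset.card_filter_add_card_filter_not (fun x => x.1.1 ≠ x.2.1)]
  have h : ((linePoints G q ×ˢ linePoints G (lineShift l q)).filter
      fun x => ¬ x.1.1 ≠ x.2.1).card ≤ (linePoints G q).card := by
    refine Finset.card_le_card_of_injOn (fun x => x.1) ?_ ?_
    · intro x hx
      simp only [Finset.coe_filter, Finset.mem_product, Set.mem_ofPred_eq] at hx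
      exact hx.1.1
    · rintro ⟨⟨a, b⟩, ⟨c, d⟩⟩ hx ⟨⟨a', b'⟩, ⟨c', d'⟩⟩ hy hxy
      simp only [Finset.coe_filter, Finset.mem_product, Set.mem_ofPred_eq, mem_linePoints,
        lineShift_apply, not_not] at hx hy
      simp only [Prod.mk.injEq] at hxy
      obtain ⟨rfl, rfl⟩ := hxy
      obtain ⟨⟨_, _, hx1⟩, rfl⟩ := hx
      obtain ⟨⟨_, _, hy1⟩, rfl⟩ := hy
      have h1 : ((q.2 * l : (ZMod p)ˣ) : ZMod p) * d = ((q.2 * l : (ZMod p)ˣ) : ZMod p) * d' := by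
        linear_combination hx1 - hy1
      have h2 : d = d' := Units.ext ((Units.mul_right_inj _).1 h1)
      rw [h2]
  exact Nat.add_le_add_left h _

/-- Two points with different first coordinates on a line `α x + β y = 1` are not
collinear with the origin. -/
theorem det_ne_zero_of_line {a b u v w z : ZMod p} (h1 : a * u + b * v = 1)
    (h2 : a * w + b * z = 1) (huw : u ≠ w) : u * z - w * v ≠ 0 := by
  intro h
  apply huw
  linear_combination w * h1 - u * h2 + b * h

theorem line_eq_of_mem_linePairs {G : Subgroup (ZMod p)ˣ} {l : (ZMod p)ˣ}
    {q r : (ZMod p)ˣ × (ZMod p)ˣ} {x : ((ZMod p)ˣ × (ZMod p)ˣ) × ((ZMod p)ˣ × (ZMod p)ˣ)}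
    (hq : x ∈ linePairs G l q) (hr : x ∈ linePairs G l r) : q = r := by
  obtain ⟨⟨u, v⟩, ⟨w, z⟩⟩ := x
  simp only [mem_linePairs, mem_linePoints, lineShift_apply, Units.val_mul] at hq hr
  obtain ⟨⟨⟨_, hq1⟩, ⟨_, hq2⟩⟩, huw⟩ := hq
  obtain ⟨⟨⟨_, hr1⟩, ⟨_, hr2⟩⟩, _⟩ := hr
  have hdet := det_ne_zero_of_line (z := (l : ZMod p) * (z : ZMod p)) hq1
    (by rw [← hq2]; ring) (fun h => huw (Units.ext h))
  refine Prod.ext (Units.ext (mul_right_cancel₀ hdet ?_)) (Units.ext (mul_right_cancel₀ hdet ?_))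
  · linear_combination (l : ZMod p) * z * (hq1 - hr1) - (v : ZMod p) * (hq2 - hr2)
  · linear_combination (u : ZMod p) * (hq2 - hr2) - (w : ZMod p) * (hq1 - hr1)

/-- A pair of distinct points lies on at most one line. -/
theorem sum_card_linePairs_le (G : Subgroup (ZMod p)ˣ) (l : (ZMod p)ˣ) :
    ∑ q, (linePairs G l q).card ≤ Nat.card G ^ 4 := by
  classical
  rw [← card_subgroupFinset, ← Finset.card_sigma]
  set S := subgroupFinset G with hS
  have h : ((S ×ˢ S) ×ˢ (S ×ˢ S)).card = S.card ^ 4 := by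
    simp only [Finset.card_product]; ring
  rw [← h]
  refine Finset.card_le_card_of_injOn (fun x => x.2) ?_ ?_
  · rintro ⟨q, x⟩ hx
    simp only [Finset.coe_sigma, Set.mem_sigma_iff, Finset.mem_coe, mem_linePairs,
      mem_linePoints] at hx
    simp only [Finset.mem_coe, Finset.mem_product, hS, mem_subgroupFinset]
    tauto
  · rintro ⟨q, x⟩ hx ⟨r, y⟩ hy hxy
    simp only [Finset.coe_sigma, Set.mem_sigma_iff, Finset.mem_coe] at hx hy hxy
    subst hxy
    rw [line_eq_of_mem_linePairs hx.2 hy.2]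

theorem card_linePoints_mul (G : Subgroup (ZMod p)ˣ) (q : (ZMod p)ˣ × (ZMod p)ˣ)
    {g h : (ZMod p)ˣ} (hg : g ∈ G) (hh : h ∈ G) :
    (linePoints G (q.1 * g, q.2 * h)).card = (linePoints G q).card := by
  refine Finset.card_bij (fun x _ => (g * x.1, h * x.2)) ?_ ?_ ?_
  · intro x hx
    simp only [mem_linePoints, Units.val_mul] at hx ⊢
    exact ⟨⟨G.mul_mem hg hx.1.1, G.mul_mem hh hx.1.2⟩, by rw [← hx.2]; ring⟩
  · intro x _ y _ hxy
    simp only [Prod.mk.injEq, mul_right_inj] at hxy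
    exact Prod.ext hxy.1 hxy.2
  · intro y hy
    simp only [mem_linePoints] at hy
    refine ⟨(g⁻¹ * y.1, h⁻¹ * y.2), ?_, by simp⟩
    simp only [mem_linePoints]
    refine ⟨⟨G.mul_mem (G.inv_mem hg) hy.1.1, G.mul_mem (G.inv_mem hh) hy.1.2⟩, ?_⟩
    rw [← hy.2]
    simp only [← Units.val_mul]
    rw [mul_assoc, mul_inv_cancel_left, mul_assoc, mul_inv_cancel_left]

/-- The point `(x, y)` of the line `α x + β y = 1` is recorded by `α x`, whose complement to `1` is
`β y`. -/
theorem card_linePoints_le_card_fiber (G : Subgroup (ZMod p)ˣ) (q : (ZMod p)ˣ × (ZMod p)ˣ) :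
    (linePoints G q).card ≤ (Finset.univ.filter fun y : ZMod p => (y ^ Nat.card G,
      (1 - y) ^ Nat.card G) = ((q.1 : ZMod p) ^ Nat.card G, (q.2 : ZMod p) ^ Nat.card G)).card := by
  have hpow : ∀ x ∈ G, (x : ZMod p) ^ Nat.card G = 1 := by
    intro x hx
    rw [← Units.val_pow_eq_pow_val,
      orderOf_dvd_iff_pow_eq_one.1 (Subgroup.orderOf_dvd_natCard G hx), Units.val_one]
  refine Finset.card_le_card_of_injOn (fun x => (q.1 : ZMod p) * x.1) ?_ ?_
  · intro x hx
    simp only [Finset.mem_coe, mem_linePoints] at hx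
    have h1 : 1 - (q.1 : ZMod p) * x.1 = (q.2 : ZMod p) * x.2 := by
      linear_combination -hx.2
    simp only [Finset.coe_filter, Finset.mem_univ, true_and, Set.mem_ofPred_eq, h1, mul_pow,
      hpow _ hx.1.1, hpow _ hx.1.2, mul_one]
  · intro x hx y hy hxy
    simp only [Finset.mem_coe, mem_linePoints] at hx hy hxy
    have h1 : x.1 = y.1 := Units.ext ((Units.mul_right_inj _).1 hxy)
    have h2 : (q.2 : ZMod p) * x.2 = q.2 * y.2 := by linear_combination hx.2 - hy.2 - hxy
    exact Prod.ext h1 (Units.ext ((Units.mul_right_inj _).1 h2))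

theorem card_units_add_eq_one :
    (Finset.univ.filter fun q : (ZMod p)ˣ × (ZMod p)ˣ => (q.1 : ZMod p) + q.2 = 1).card =
      p - 2 := by
  classical
  have h : (Finset.univ.erase (1 : (ZMod p)ˣ)).card = p - 2 := by
    rw [Finset.card_erase_of_mem (Finset.mem_univ _), Finset.card_univ, ZMod.card_units]
    omega
  rw [← h]
  refine Finset.card_bij (fun q _ => q.1) ?_ ?_ ?_
  · intro q hq
    simp only [Finset.mem_filter, Finset.mem_univ, true_and] at hq
    refine Finset.mem_erase.2 ⟨fun h1 => q.2.ne_zero ?_, Finset.mem_univ _⟩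
    rw [h1, Units.val_one] at hq
    linear_combination hq
  · intro q hq r hr hqr
    simp only [Finset.mem_filter, Finset.mem_univ, true_and] at hq hr hqr
    refine Prod.ext hqr (Units.ext ?_)
    rw [hqr] at hq
    linear_combination hq - hr
  · intro a ha
    have ha1 : (1 : ZMod p) - a ≠ 0 := by
      intro h0
      exact (Finset.mem_erase.1 ha).1 (Units.ext (by rw [Units.val_one]; linear_combination -h0))
    exact ⟨(a, Units.mk0 _ ha1), by simp, rfl⟩

theorem sum_card_linePoints (G : Subgroup (ZMod p)ˣ) :
    ∑ q, (linePoints G q).card = Nat.card G ^ 2 * (p - 2) := by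
  classical
  simp only [linePoints, Finset.card_filter]
  rw [Finset.sum_comm]
  have h : ∀ x ∈ subgroupFinset G ×ˢ subgroupFinset G,
      ∑ q : (ZMod p)ˣ × (ZMod p)ˣ,
        (if (q.1 : ZMod p) * x.1 + (q.2 : ZMod p) * x.2 = 1 then 1 else 0) = p - 2 := by
    intro x _
    rw [← card_units_add_eq_one, Finset.card_filter]
    refine Fintype.sum_equiv (Equiv.prodCongr (Equiv.mulRight x.1) (Equiv.mulRight x.2)) _ _ ?_
    intro q
    simp
  rw [Finset.sum_congr rfl h, Finset.sum_const, Finset.card_product, card_subgroupFinset,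
    smul_eq_mul, sq]

/-! ### Collinear triples and lines -/

/-- Up to the triples on lines through the origin, collinear triples are counted line by line. -/
theorem exists_subgroupCollinearTriples_eq (l : (ZMod p)ˣ) (G : Subgroup (ZMod p)ˣ) :
    ∃ t ≤ Nat.card G ^ 4, subgroupCollinearTriples l G =
      t + ∑ q, (linePairs G l q).card * (linePoints G (lineShift l q)).card := by
  classical
  set S := subgroupFinset G with hS
  set T := (collinearTripleSet 1 l (G : Set (ZMod p)ˣ) (G : Set (ZMod p)ˣ)).toFinset with hT
  have hmem : ∀ u₁ v₁ w₁ u₂ v₂ w₂ : (ZMod p)ˣ, ((u₁, v₁, w₁), (u₂, v₂, w₂)) ∈ T ↔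
      (u₁ ∈ G ∧ v₁ ∈ G ∧ w₁ ∈ G) ∧ (u₂ ∈ G ∧ v₂ ∈ G ∧ w₂ ∈ G) ∧
      (u₁ : ZMod p) - w₁ ≠ 0 ∧ (u₂ : ZMod p) - l * w₂ ≠ 0 ∧
      ((u₁ : ZMod p) - v₁) * (u₂ - l * w₂) = ((u₂ : ZMod p) - l * v₂) * (u₁ - w₁) := by
    intro u₁ v₁ w₁ u₂ v₂ w₂
    rw [hT, Set.mem_toFinset]
    simp only [collinearTripleSet, Set.mem_ofPred_eq, Units.val_one, one_mul, SetLike.mem_coe]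
    refine and_congr_right fun _ => and_congr_right fun _ => and_congr_right fun h1 =>
      and_congr_right fun h2 => ?_
    rw [div_eq_div_iff h1 h2]
  refine ⟨(T.filter fun x => (x.1.1 : ZMod p) * (l * x.2.2.2) - x.1.2.2 * x.2.1 = 0).card,
    ?_, ?_⟩
  · have h : ((S ×ˢ S) ×ˢ (S ×ˢ S)).card = Nat.card G ^ 4 := by
      simp only [Finset.card_product, hS, card_subgroupFinset]; ring
    rw [← h]
    refine Finset.card_le_card_of_injOn (fun x => ((x.1.1, x.2.1), (x.1.2.2, x.1.2.1))) ?_ ?_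
    · rintro ⟨⟨u₁, v₁, w₁⟩, ⟨u₂, v₂, w₂⟩⟩ hx
      simp only [Finset.coe_filter, Set.mem_ofPred_eq, hmem] at hx
      simp only [Finset.mem_coe, Finset.mem_product, hS, mem_subgroupFinset]
      tauto
    · rintro ⟨⟨u₁, v₁, w₁⟩, ⟨u₂, v₂, w₂⟩⟩ hx ⟨⟨u₁', v₁', w₁'⟩, ⟨u₂', v₂', w₂'⟩⟩ hy hxy
      simp only [Finset.coe_filter, Set.mem_ofPred_eq, hmem] at hx hy
      simp only [Prod.mk.injEq] at hxy
      obtain ⟨⟨rfl, rfl⟩, ⟨rfl, rfl⟩⟩ := hxy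
      obtain ⟨⟨_, _, h1, _, hx2⟩, hx3⟩ := hx
      obtain ⟨⟨_, _, _, _, hy2⟩, hy3⟩ := hy
      have hw : w₂ = w₂' := by
        refine Units.ext (mul_left_cancel₀ (mul_ne_zero u₁.ne_zero l.ne_zero) ?_)
        linear_combination hx3 - hy3
      subst hw
      have hv : v₂ = v₂' := by
        refine Units.ext (mul_left_cancel₀ (mul_ne_zero l.ne_zero h1) ?_)
        linear_combination hx2 - hy2
      rw [hv]
  · rw [subgroupCollinearTriples, collinearTriples, Set.ncard_eq_toFinset_card', ← hT,
      ← Finset.card_filter_add_card_filter_not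
        (fun x => (x.1.1 : ZMod p) * (l * x.2.2.2) - x.1.2.2 * x.2.1 = 0)]
    congr 1
    simp only [← Finset.card_product]
    rw [← Finset.card_sigma]
    symm
    refine Finset.card_bij
      (fun x _ => ((x.2.1.1.1, x.2.2.1, x.2.1.2.1), (x.2.1.1.2, x.2.2.2, x.2.1.2.2))) ?_ ?_ ?_
    · rintro ⟨⟨a, b⟩, ⟨⟨u₁, u₂⟩, ⟨w₁, w₂⟩⟩, ⟨v₁, v₂⟩⟩ hx
      simp only [Finset.mem_sigma, Finset.mem_univ, true_and, Finset.mem_product, mem_linePairs,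
        mem_linePoints, lineShift_apply, Units.val_mul] at hx
      obtain ⟨⟨⟨⟨hu, h1⟩, ⟨hw, h2⟩⟩, hne⟩, ⟨hv, h3⟩⟩ := hx
      rw [Finset.mem_filter, hmem]
      have hne1 : (u₁ : ZMod p) - w₁ ≠ 0 := sub_ne_zero.2 fun h => hne (Units.ext h)
      have hne2 : (u₂ : ZMod p) - l * w₂ ≠ 0 := by
        intro h
        refine mul_ne_zero a.ne_zero hne1 ?_
        linear_combination h1 - h2 - (b : ZMod p) * h
      refine ⟨⟨⟨hu.1, hv.1, hw.1⟩, ⟨hu.2, hv.2, hw.2⟩, hne1, hne2, ?_⟩, ?_⟩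
      · refine mul_left_cancel₀ a.ne_zero ?_
        linear_combination ((u₂ : ZMod p) - l * w₂) * (h1 - h3) - (u₂ - l * v₂) * (h1 - h2)
      · exact det_ne_zero_of_line h1 (by rw [← h2]; ring)
          (fun h => hne (Units.ext h))
    · rintro ⟨q, ⟨⟨u₁, u₂⟩, ⟨w₁, w₂⟩⟩, ⟨v₁, v₂⟩⟩ hx ⟨r, ⟨⟨u₁', u₂'⟩, ⟨w₁', w₂'⟩⟩, ⟨v₁', v₂'⟩⟩ hy hxy
      simp only [Prod.mk.injEq] at hxy
      obtain ⟨⟨rfl, rfl, rfl⟩, ⟨rfl, rfl, rfl⟩⟩ := hxy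
      simp only [Finset.mem_sigma, Finset.mem_univ, true_and, Finset.mem_product] at hx hy
      rw [line_eq_of_mem_linePairs hx.1 hy.1]
    · rintro ⟨⟨u₁, v₁, w₁⟩, ⟨u₂, v₂, w₂⟩⟩ hx
      rw [Finset.mem_filter, hmem] at hx
      obtain ⟨⟨hx1, hx2, h1, h2, h3⟩, hdet⟩ := hx
      simp only at hdet
      set d : ZMod p := (u₁ : ZMod p) * (l * w₂) - w₁ * u₂ with hd
      have h2' : (l : ZMod p) * w₂ - u₂ ≠ 0 := fun h => h2 (by linear_combination -h)
      refine ⟨⟨(Units.mk0 (((l : ZMod p) * w₂ - u₂) / d) (div_ne_zero h2' hdet),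
        Units.mk0 (((u₁ : ZMod p) - w₁) / d) (div_ne_zero h1 hdet)),
        ((u₁, u₂), (w₁, w₂)), (v₁, v₂)⟩, ?_, rfl⟩
      simp only [Finset.mem_sigma, Finset.mem_univ, true_and, Finset.mem_product, mem_linePairs,
        mem_linePoints, lineShift_apply, Units.val_mul, Units.val_mk0]
      refine ⟨⟨⟨⟨⟨hx1.1, hx2.1⟩, ?_⟩, ⟨⟨hx1.2.2, hx2.2.2⟩, ?_⟩⟩,
        fun h => h1 (by rw [h, sub_self])⟩, ⟨hx1.2.1, hx2.2.1⟩, ?_⟩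
      · field_simp
        rw [hd]; ring
      · field_simp
        rw [hd]; ring
      · field_simp
        rw [hd]; linear_combination h3

/-! ### Mean square of the number of points on a line -/

theorem natCard_subgroup_pos (G : Subgroup (ZMod p)ˣ) : 0 < Nat.card G := Nat.card_pos

theorem natCard_subgroup_le (G : Subgroup (ZMod p)ˣ) : Nat.card G ≤ p := by
  refine (Subgroup.card_le_card_group G).trans ?_
  rw [Nat.card_eq_fintype_card, ZMod.card_units]
  omega

theorem card_linePoints_le (G : Subgroup (ZMod p)ˣ) (q : (ZMod p)ˣ × (ZMod p)ˣ) :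
    (linePoints G q).card ≤ Nat.card G ^ 2 := by
  refine (Finset.card_filter_le _ _).trans ?_
  rw [Finset.card_product, card_subgroupFinset, sq]

theorem sum_lineShift {M : Type*} [AddCommMonoid M] (l : (ZMod p)ˣ)
    (f : (ZMod p)ˣ × (ZMod p)ˣ → M) : ∑ q, f (lineShift l q) = ∑ q, f q :=
  Equiv.sum_comp (lineShift l) f

theorem sum_card_linePoints_sq_le (G : Subgroup (ZMod p)ˣ) :
    ∑ q, (linePoints G q).card ^ 2 ≤ Nat.card G ^ 4 + Nat.card G ^ 2 * (p - 2) := by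
  rw [← sum_card_linePoints]
  refine le_trans ?_ (Nat.add_le_add_right (sum_card_linePairs_le G 1) _)
  rw [← Finset.sum_add_distrib]
  refine Finset.sum_le_sum fun q _ => ?_
  have h := mul_card_le_card_linePairs_add G 1 q
  have h1 : lineShift 1 q = q := by rw [lineShift_apply, mul_one]
  rwa [h1, ← sq] at h

/-- The deviation of the number of points of `G × G` on a line from its expected value
`|G| ^ 2 / p`. -/
noncomputable def lineError (G : Subgroup (ZMod p)ˣ) (q : (ZMod p)ˣ × (ZMod p)ˣ) : ℝ :=
  ((linePoints G q).card : ℝ) - (Nat.card G : ℝ) ^ 2 / p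

theorem cast_prime_sub_two : ((p - 2 : ℕ) : ℝ) = (p : ℝ) - 2 := by
  have := (Fact.out : p.Prime).two_le
  rw [Nat.cast_sub this]; norm_num

theorem card_lines : ((Finset.univ : Finset ((ZMod p)ˣ × (ZMod p)ˣ)).card : ℝ) =
    ((p : ℝ) - 1) ^ 2 := by
  have := (Fact.out : p.Prime).one_le
  rw [Finset.card_univ, Fintype.card_prod, ZMod.card_units, Nat.cast_mul, Nat.cast_sub this]
  push_cast; ring

theorem sum_card_linePoints_real (G : Subgroup (ZMod p)ˣ) :
    ∑ q, ((linePoints G q).card : ℝ) = (Nat.card G : ℝ) ^ 2 * ((p : ℝ) - 2) := by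
  rw [← cast_prime_sub_two]
  exact_mod_cast sum_card_linePoints G

theorem sum_lineError (G : Subgroup (ZMod p)ˣ) :
    ∑ q, lineError G q = -((Nat.card G : ℝ) ^ 2 / p) := by
  have hp : (p : ℝ) ≠ 0 := Nat.cast_ne_zero.2 (Fact.out : p.Prime).ne_zero
  simp only [lineError, Finset.sum_sub_distrib, sum_card_linePoints_real, Finset.sum_const,
    nsmul_eq_mul, card_lines]
  field_simp
  ring

theorem sum_lineError_sq_le (G : Subgroup (ZMod p)ˣ) :
    ∑ q, lineError G q ^ 2 ≤ 4 * (Nat.card G : ℝ) ^ 2 * p := by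
  have hp : (0 : ℝ) < p := Nat.cast_pos.2 (Fact.out : p.Prime).pos
  have hp1 : (1 : ℝ) ≤ p := Nat.one_le_cast.2 (Fact.out : p.Prime).one_le
  have hnp : (Nat.card G : ℝ) ≤ p := Nat.cast_le.2 (natCard_subgroup_le G)
  have h2 : ∑ q, ((linePoints G q).card : ℝ) ^ 2 ≤
      (Nat.card G : ℝ) ^ 4 + (Nat.card G : ℝ) ^ 2 * ((p : ℝ) - 2) := by
    rw [← cast_prime_sub_two]
    exact_mod_cast sum_card_linePoints_sq_le G
  have h1 := sum_card_linePoints_real G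
  set n : ℝ := (Nat.card G : ℝ) with hn
  have hn0 : 0 ≤ n := Nat.cast_nonneg _
  have hexp : ∑ q, lineError G q ^ 2 = ∑ q, ((linePoints G q).card : ℝ) ^ 2 -
      2 * (n ^ 2 / p) * ∑ q, ((linePoints G q).card : ℝ) + (p - 1) ^ 2 * (n ^ 2 / p) ^ 2 := by
    rw [← card_lines, ← nsmul_eq_mul, ← Finset.sum_const, Finset.mul_sum,
      ← Finset.sum_sub_distrib, ← Finset.sum_add_distrib]
    refine Finset.sum_congr rfl fun q _ => ?_
    rw [lineError]; ring
  rw [hexp, h1]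
  have hx : n ^ 4 - 2 * (n ^ 2 / p) * (n ^ 2 * (p - 2)) + (p - 1) ^ 2 * (n ^ 2 / p) ^ 2 =
      n ^ 2 * (n / p) ^ 2 * (2 * p + 1) := by
    field_simp
    ring
  have h3 : (n / p) ^ 2 ≤ 1 := by
    refine pow_le_one₀ (by positivity) ((div_le_one hp).2 hnp)
  have h4 : n ^ 2 * (n / p) ^ 2 * (2 * p + 1) ≤ n ^ 2 * 1 * (3 * p) := by
    gcongr
    linarith
  nlinarith [sq_nonneg n]

/-- Since the deviation is invariant under `G × G`, its mean square controls each value. -/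
theorem lineError_sq_le (G : Subgroup (ZMod p)ˣ) (q : (ZMod p)ˣ × (ZMod p)ˣ) :
    lineError G q ^ 2 ≤ 4 * p := by
  classical
  have hn : (0 : ℝ) < Nat.card G := Nat.cast_pos.2 (natCard_subgroup_pos G)
  set S := subgroupFinset G ×ˢ subgroupFinset G with hS
  have hcard : (S.card : ℝ) = (Nat.card G : ℝ) ^ 2 := by
    rw [hS, Finset.card_product, card_subgroupFinset]; push_cast; ring
  have h1 : ∑ x ∈ S, lineError G (q.1 * x.1, q.2 * x.2) ^ 2 =
      (Nat.card G : ℝ) ^ 2 * lineError G q ^ 2 := by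
    rw [← hcard, ← nsmul_eq_mul, ← Finset.sum_const]
    refine Finset.sum_congr rfl fun x hx => ?_
    simp only [hS, Finset.mem_product, mem_subgroupFinset] at hx
    rw [lineError, card_linePoints_mul G q hx.1 hx.2, lineError]
  have hinj : Set.InjOn (fun x : (ZMod p)ˣ × (ZMod p)ˣ => (q.1 * x.1, q.2 * x.2)) S := by
    intro x _ y _ hxy
    simp only [Prod.mk.injEq, mul_right_inj] at hxy
    exact Prod.ext hxy.1 hxy.2
  have h2 : ∑ x ∈ S, lineError G (q.1 * x.1, q.2 * x.2) ^ 2 ≤ ∑ r, lineError G r ^ 2 := by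
    rw [← Finset.sum_image (f := fun r => lineError G r ^ 2) hinj]
    exact Finset.sum_le_sum_of_subset_of_nonneg (Finset.subset_univ _)
      fun _ _ _ => sq_nonneg _
  have h3 := h2.trans (sum_lineError_sq_le G)
  rw [h1] at h3
  have h4 : (0 : ℝ) < (Nat.card G : ℝ) ^ 2 := by positivity
  nlinarith

theorem card_pow_eq_le {n : ℕ} (hn : 0 < n) (s : ZMod p) :
    (Finset.univ.filter fun a : (ZMod p)ˣ => (a : ZMod p) ^ n = s).card ≤ n := by
  classical
  refine le_trans ?_ (Polynomial.card_nthRoots n s)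
  refine le_trans ?_ (Multiset.toFinset_card_le _)
  refine Finset.card_le_card_of_injOn (fun a : (ZMod p)ˣ => (a : ZMod p)) ?_ ?_
  · intro a ha
    simp only [Finset.coe_filter, Finset.mem_univ, true_and, Set.mem_ofPred_eq] at ha
    simpa [Polynomial.mem_nthRoots hn] using ha
  · intro a _ b _ hab
    exact Units.ext hab

/-! ### Rich lines -/

/-- Few lines are rich: the lines with at least `τ` points of `G × G` form at most
`2 ^ 15 |G| ^ 2 / τ ^ 3` orbits under `G × G`. -/
theorem card_rich_lines_mul_le (G : Subgroup (ZMod p)ˣ) {τ : ℕ} (hτ : 256 ≤ τ)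
    (hτp : 256 * Nat.card G ^ 2 ≤ p * τ) :
    (Finset.univ.filter fun q => τ ≤ (linePoints G q).card).card * τ ^ 3 ≤
      2 ^ 15 * Nat.card G ^ 4 := by
  classical
  have hn0 := natCard_subgroup_pos G
  set n := Nat.card G with hn
  set R := Finset.univ.filter fun q => τ ≤ (linePoints G q).card with hR
  set f : (ZMod p)ˣ × (ZMod p)ˣ → ZMod p × ZMod p :=
    fun q => ((q.1 : ZMod p) ^ n, (q.2 : ZMod p) ^ n) with hf
  have hfib : R.card ≤ n ^ 2 * (R.image f).card := by
    refine Finset.card_le_mul_card_image _ _ fun v _ => ?_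
    calc (R.filter fun q => f q = v).card
        ≤ ((Finset.univ.filter fun a : (ZMod p)ˣ => (a : ZMod p) ^ n = v.1) ×ˢ
          (Finset.univ.filter fun a : (ZMod p)ˣ => (a : ZMod p) ^ n = v.2)).card := by
          refine Finset.card_le_card fun q hq => ?_
          simp only [Finset.mem_filter, hf, Prod.ext_iff] at hq
          simp only [Finset.mem_product, Finset.mem_filter, Finset.mem_univ, true_and]
          exact hq.2
      _ ≤ n * n := by
          rw [Finset.card_product]
          exact Nat.mul_le_mul (card_pow_eq_le hn0 _) (card_pow_eq_le hn0 _)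
      _ = n ^ 2 := (sq n).symm
  suffices hI : (R.image f).card * τ ^ 3 ≤ 2 ^ 15 * n ^ 2 by
    calc R.card * τ ^ 3 ≤ n ^ 2 * (R.image f).card * τ ^ 3 := Nat.mul_le_mul_right _ hfib
      _ = n ^ 2 * ((R.image f).card * τ ^ 3) := by ring
      _ ≤ n ^ 2 * (2 ^ 15 * n ^ 2) := Nat.mul_le_mul_left _ hI
      _ = 2 ^ 15 * n ^ 4 := by ring
  by_contra hcon
  push Not at hcon
  -- a minimal number `h` of orbits violating the bound satisfies the hypotheses of the
  -- Stepanov estimate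
  have hex : ∃ h, 2 ^ 15 * n ^ 2 < h * τ ^ 3 := ⟨_, hcon⟩
  obtain ⟨h, hh, hmin, hle⟩ : ∃ h, 2 ^ 15 * n ^ 2 < h * τ ^ 3 ∧
      (h - 1) * τ ^ 3 ≤ 2 ^ 15 * n ^ 2 ∧ h ≤ (R.image f).card := by
    refine ⟨Nat.find hex, Nat.find_spec hex, ?_, Nat.find_le hcon⟩
    rcases Nat.eq_zero_or_pos (Nat.find hex) with h0 | h0
    · rw [h0]; simp
    · exact not_lt.1 (Nat.find_min hex (Nat.sub_lt h0 one_pos))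
  have hpos : 0 < h := by
    rcases Nat.eq_zero_or_pos h with h0 | h0
    · rw [h0] at hh; simp at hh
    · exact h0
  obtain ⟨V, hVI, hVh⟩ := Finset.exists_subset_card_eq hle
  have hτ3 : 2 ^ 24 ≤ τ ^ 3 := by
    calc 2 ^ 24 = 256 ^ 3 := by norm_num
      _ ≤ τ ^ 3 := Nat.pow_le_pow_left hτ 3
  have hτ3pos : 0 < τ ^ 3 := by omega
  obtain ⟨v, hv⟩ : (R.image f).Nonempty := Finset.card_pos.1 (hpos.trans_le hle)
  obtain ⟨q, hq, _⟩ := Finset.mem_image.1 hv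
  have hqτ : τ ≤ (linePoints G q).card := (Finset.mem_filter.1 hq).2
  have hn2 : 256 ≤ n ^ 2 := hτ.trans (hqτ.trans (card_linePoints_le G q))
  -- if `64 n ^ 4 > p ^ 3`, then the mean square bound excludes rich lines altogether
  have hnp : 64 * n ^ 4 ≤ p ^ 3 := by
    have hp : (0 : ℝ) < p := Nat.cast_pos.2 (Fact.out : p.Prime).pos
    have h1 := lineError_sq_le G q
    have h2 : (256 : ℝ) * n ^ 2 / p ≤ (linePoints G q).card := by
      rw [div_le_iff₀ hp]
      have h3 : 256 * n ^ 2 ≤ (linePoints G q).card * p :=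
        hτp.trans (by rw [mul_comm]; exact Nat.mul_le_mul_right _ hqτ)
      exact_mod_cast h3
    have h3 : (255 : ℝ) * (n ^ 2 / p) ≤ lineError G q := by
      rw [lineError, ← hn]
      have : (256 : ℝ) * n ^ 2 / p = 255 * (n ^ 2 / p) + n ^ 2 / p := by ring
      linarith
    have h4 : ((255 : ℝ) * (n ^ 2 / p)) ^ 2 ≤ 4 * p :=
      (pow_le_pow_left₀ (by positivity) h3 2).trans h1
    have h5 : ((255 : ℝ) * (n ^ 2 / p)) ^ 2 = 255 ^ 2 * n ^ 4 / p ^ 2 := by ring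
    rw [h5, div_le_iff₀ (by positivity)] at h4
    have h6 : (64 : ℝ) * n ^ 4 ≤ (p : ℝ) ^ 3 := by
      have : (0 : ℝ) ≤ (n : ℝ) ^ 4 := by positivity
      nlinarith
    exact_mod_cast h6
  have key := card_mul_pow_three_le (p := p) (n := n) (τ := τ) V ?_ ?_ ?_ ?_
  · rw [hVh] at key
    omega
  · intro v hv
    obtain ⟨r, _, rfl⟩ := Finset.mem_image.1 (hVI hv)
    exact ⟨pow_ne_zero _ r.1.ne_zero, pow_ne_zero _ r.2.ne_zero⟩
  · rw [hVh]
    rcases Nat.lt_or_ge 1 h with h1 | h1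
    · have h2 : h ≤ 2 * (h - 1) := by omega
      refine Nat.lt_of_mul_lt_mul_right (a := τ ^ 3) ?_
      calc 8 * h * τ ^ 3 ≤ 8 * (2 * (h - 1)) * τ ^ 3 := by gcongr
        _ = 16 * ((h - 1) * τ ^ 3) := by ring
        _ ≤ 16 * (2 ^ 15 * n ^ 2) := by gcongr
        _ < n ^ 2 * 2 ^ 24 := by omega
        _ ≤ n ^ 2 * τ ^ 3 := by gcongr
    · omega
  · rw [hVh]
    rcases Nat.lt_or_ge 1 h with h1 | h1
    · have h2 : h ≤ 2 * (h - 1) := by omega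
      refine Nat.le_of_mul_le_mul_right (c := τ ^ 3) ?_ hτ3pos
      calc 64 * h * n ^ 4 * τ ^ 3 ≤ 64 * (2 * (h - 1)) * n ^ 4 * τ ^ 3 := by gcongr
        _ = 128 * n ^ 4 * ((h - 1) * τ ^ 3) := by ring
        _ ≤ 128 * n ^ 4 * (2 ^ 15 * n ^ 2) := by gcongr
        _ = 2 ^ 22 * n ^ 6 := by ring
        _ ≤ 2 ^ 24 * n ^ 6 := by gcongr <;> norm_num
        _ = (256 * n ^ 2) ^ 3 := by ring
        _ ≤ (p * τ) ^ 3 := by gcongr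
        _ = p ^ 3 * τ ^ 3 := by ring
    · have : h = 1 := by omega
      rw [this, mul_one]
      exact hnp
  · intro v hv
    obtain ⟨r, hr, rfl⟩ := Finset.mem_image.1 (hVI hv)
    exact (Finset.mem_filter.1 hr).2.trans (card_linePoints_le_card_fiber G r)

theorem pow_three_le_sum_Ioc (N : ℕ) : N ^ 3 ≤ 8 * ∑ τ ∈ Finset.Ioc (N / 2) N, τ ^ 2 := by
  have h1 : (N - N / 2) * (N / 2 + 1) ^ 2 ≤ ∑ τ ∈ Finset.Ioc (N / 2) N, τ ^ 2 := by
    rw [← Nat.card_Ioc, ← smul_eq_mul]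
    refine Finset.card_nsmul_le_sum _ _ _ fun τ hτ => ?_
    exact Nat.pow_le_pow_left (Finset.mem_Ioc.1 hτ).1 2
  calc N ^ 3 = N * N ^ 2 := by ring
    _ ≤ (2 * (N - N / 2)) * (2 * (N / 2 + 1)) ^ 2 :=
        Nat.mul_le_mul (by omega) (Nat.pow_le_pow_left (by omega) 2)
    _ = 8 * ((N - N / 2) * (N / 2 + 1) ^ 2) := by ring
    _ ≤ _ := Nat.mul_le_mul_left _ h1

/-- The contribution of rich lines to the third moment. -/
theorem sum_rich_lines_pow_three_le (G : Subgroup (ZMod p)ˣ) {K : ℕ} (hK : 256 ≤ K)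
    (hKp : 256 * Nat.card G ^ 2 ≤ p * K) :
    ∑ q with 2 * K ≤ (linePoints G q).card, ((linePoints G q).card : ℝ) ^ 3 ≤
      2 ^ 18 * (Nat.card G : ℝ) ^ 4 * (1 + 2 * Real.log (Nat.card G)) := by
  classical
  set n := Nat.card G with hn
  have h1 : ∑ q with 2 * K ≤ (linePoints G q).card, (linePoints G q).card ^ 3 ≤
      8 * ∑ τ ∈ Finset.Ioc K (n ^ 2),
        (Finset.univ.filter fun q => τ ≤ (linePoints G q).card).card * τ ^ 2 := by
    calc ∑ q with 2 * K ≤ (linePoints G q).card, (linePoints G q).card ^ 3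
        ≤ ∑ q with 2 * K ≤ (linePoints G q).card, 8 * ∑ τ ∈ Finset.Ioc K (n ^ 2),
          if τ ≤ (linePoints G q).card then τ ^ 2 else 0 := by
          refine Finset.sum_le_sum fun q hq => (pow_three_le_sum_Ioc _).trans ?_
          rw [← Finset.sum_filter]
          refine Nat.mul_le_mul_left _ (Finset.sum_le_sum_of_subset fun τ hτ => ?_)
          have hq' : 2 * K ≤ (linePoints G q).card := (Finset.mem_filter.1 hq).2
          have hle : (linePoints G q).card ≤ n ^ 2 := card_linePoints_le G q
          simp only [Finset.mem_filter, Finset.mem_Ioc] at hτ ⊢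
          omega
      _ ≤ ∑ q, 8 * ∑ τ ∈ Finset.Ioc K (n ^ 2),
          if τ ≤ (linePoints G q).card then τ ^ 2 else 0 :=
          Finset.sum_le_sum_of_subset (Finset.filter_subset _ _)
      _ = _ := by
          rw [← Finset.mul_sum, Finset.sum_comm]
          congr 1
          refine Finset.sum_congr rfl fun τ _ => ?_
          rw [← Finset.sum_filter, Finset.sum_const, smul_eq_mul]
  have h2 : ∀ τ ∈ Finset.Ioc K (n ^ 2),
      (((Finset.univ.filter fun q => τ ≤ (linePoints G q).card).card * τ ^ 2 : ℕ) : ℝ) ≤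
        2 ^ 15 * (n : ℝ) ^ 4 * (τ : ℝ)⁻¹ := by
    intro τ hτ
    have hτK : K < τ := (Finset.mem_Ioc.1 hτ).1
    have hτ0 : (0 : ℝ) < τ := Nat.cast_pos.2 (by omega)
    have h3 := card_rich_lines_mul_le G (τ := τ) (by omega)
      (hKp.trans (Nat.mul_le_mul_left _ hτK.le))
    rw [← div_eq_mul_inv, le_div_iff₀ hτ0]
    have h4 : (Finset.univ.filter fun q => τ ≤ (linePoints G q).card).card * τ ^ 2 * τ ≤
        2 ^ 15 * n ^ 4 := by
      refine le_trans (le_of_eq ?_) h3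
      ring
    exact_mod_cast h4
  have h3 : ∑ τ ∈ Finset.Ioc K (n ^ 2), (τ : ℝ)⁻¹ ≤ 1 + 2 * Real.log n := by
    calc ∑ τ ∈ Finset.Ioc K (n ^ 2), (τ : ℝ)⁻¹ ≤ ∑ τ ∈ Finset.Icc 1 (n ^ 2), (τ : ℝ)⁻¹ := by
          refine Finset.sum_le_sum_of_subset_of_nonneg (fun τ hτ => ?_)
            fun _ _ _ => by positivity
          simp only [Finset.mem_Ioc, Finset.mem_Icc] at hτ ⊢
          omega
      _ = (harmonic (n ^ 2) : ℝ) := by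
          rw [harmonic_eq_sum_Icc]; push_cast; rfl
      _ ≤ 1 + Real.log ((n ^ 2 : ℕ) : ℝ) := harmonic_le_one_add_log _
      _ = 1 + 2 * Real.log n := by
          rw [Nat.cast_pow, Real.log_pow]; norm_num
  calc ∑ q with 2 * K ≤ (linePoints G q).card, ((linePoints G q).card : ℝ) ^ 3
      = ((∑ q with 2 * K ≤ (linePoints G q).card, (linePoints G q).card ^ 3 : ℕ) : ℝ) := by
        push_cast; rfl
    _ ≤ ((8 * ∑ τ ∈ Finset.Ioc K (n ^ 2),
        (Finset.univ.filter fun q => τ ≤ (linePoints G q).card).card * τ ^ 2 : ℕ) : ℝ) :=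
        Nat.cast_le.2 h1
    _ ≤ 8 * ∑ τ ∈ Finset.Ioc K (n ^ 2), 2 ^ 15 * (n : ℝ) ^ 4 * (τ : ℝ)⁻¹ := by
        rw [Nat.cast_mul, Nat.cast_sum]
        push_cast
        refine mul_le_mul_of_nonneg_left (Finset.sum_le_sum fun τ hτ => ?_) (by norm_num)
        exact_mod_cast h2 τ hτ
    _ = 2 ^ 18 * (n : ℝ) ^ 4 * ∑ τ ∈ Finset.Ioc K (n ^ 2), (τ : ℝ)⁻¹ := by
        rw [← Finset.mul_sum]; ring
    _ ≤ _ := by gcongr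

/-! ### Asymptotic formulas -/

/-- A majorant of the number of collinear triples, effective when the expected number of points on a
line is at most one. -/
theorem subgroupCollinearTriples_le_of_sq_le (l : (ZMod p)ˣ) (G : Subgroup (ZMod p)ˣ)
    (h : Nat.card G ^ 2 ≤ p) :
    (subgroupCollinearTriples l G : ℝ) ≤
      2 ^ 20 * (Nat.card G : ℝ) ^ 4 * (1 + 2 * Real.log (Nat.card G)) := by
  classical
  obtain ⟨t, ht, hT⟩ := exists_subgroupCollinearTriples_eq l G
  have hrich := sum_rich_lines_pow_three_le G (K := 256) le_rfl (by linarith)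
  have hpairs := sum_card_linePairs_le G l
  set N : (ZMod p)ˣ × (ZMod p)ˣ → ℝ := fun q => ((linePoints G q).card : ℝ) with hN
  set r : (ZMod p)ˣ × (ZMod p)ˣ → ℝ :=
    fun q => if 2 * 256 ≤ (linePoints G q).card then N q ^ 3 else 0 with hr
  have hr0 : ∀ q, 0 ≤ r q := by
    intro q
    simp only [hr, hN]
    split_ifs <;> positivity
  rw [Finset.sum_filter] at hrich
  have hpt : ∀ q, ((linePairs G l q).card : ℝ) * N (lineShift l q) ≤
      512 * ((linePairs G l q).card : ℝ) + r q + r (lineShift l q) := by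
    intro q
    have hP : ((linePairs G l q).card : ℝ) ≤ N q * N (lineShift l q) := by
      simp only [hN]
      exact_mod_cast card_linePairs_le G l q
    have hP0 : (0 : ℝ) ≤ (linePairs G l q).card := Nat.cast_nonneg _
    have hN0 : 0 ≤ N q := Nat.cast_nonneg _
    have hM0 : 0 ≤ N (lineShift l q) := Nat.cast_nonneg _
    have hr1 := hr0 q
    have hr2 := hr0 (lineShift l q)
    -- either the factor `N (lineShift l q)` is bounded, or the larger of the two numbers of points
    -- is that of a rich line
    by_cases hM : N (lineShift l q) ≤ 512
    · have := mul_le_mul_of_nonneg_left hM hP0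
      linarith
    · have hM' : 2 * 256 ≤ (linePoints G (lineShift l q)).card := by
        by_contra hcon
        exact hM (by simp only [hN]; exact_mod_cast (by omega :
          (linePoints G (lineShift l q)).card ≤ 512))
      have h2 : r (lineShift l q) = N (lineShift l q) ^ 3 := if_pos hM'
      by_cases hNM : N q ≤ N (lineShift l q)
      · have h3 : ((linePairs G l q).card : ℝ) * N (lineShift l q) ≤
            N (lineShift l q) * N (lineShift l q) * N (lineShift l q) := by
          gcongr
          exact hP.trans (by gcongr)
        rw [h2]
        nlinarith
      · push Not at hNM
        have hN' : 2 * 256 ≤ (linePoints G q).card :=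
          by
          refine hM'.trans ?_
          simp only [hN] at hNM
          exact_mod_cast hNM.le
        have h1 : r q = N q ^ 3 := if_pos hN'
        have h3 : ((linePairs G l q).card : ℝ) * N (lineShift l q) ≤ N q * N q * N q := by
          gcongr
          exact hP.trans (by gcongr)
        rw [h1]
        nlinarith
  have hsum : ∑ q, ((linePairs G l q).card : ℝ) * N (lineShift l q) ≤
      512 * (Nat.card G : ℝ) ^ 4 + 2 * ∑ q, r q := by
    have h1 := Finset.sum_le_sum fun q (_ : q ∈ Finset.univ) => hpt q
    rw [Finset.sum_add_distrib, Finset.sum_add_distrib, ← Finset.mul_sum, sum_lineShift] at h1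
    have h2 : ∑ q, ((linePairs G l q).card : ℝ) ≤ (Nat.card G : ℝ) ^ 4 := by
      exact_mod_cast hpairs
    linarith
  have hTr : (subgroupCollinearTriples l G : ℝ) =
      t + ∑ q, ((linePairs G l q).card : ℝ) * N (lineShift l q) := by
    rw [hT]; push_cast; rfl
  have ht' : (t : ℝ) ≤ (Nat.card G : ℝ) ^ 4 := by exact_mod_cast ht
  have hlog : 0 ≤ Real.log (Nat.card G) := Real.log_natCast_nonneg _
  have hn4 : (0 : ℝ) ≤ (Nat.card G : ℝ) ^ 4 := by positivity
  have hprod : 0 ≤ (Nat.card G : ℝ) ^ 4 * Real.log (Nat.card G) := mul_nonneg hn4 hlog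
  rw [hTr]
  simp only [hr] at hsum
  nlinarith

/-- If a line is expected to contain at least one point, the error in the asymptotic formula is
controlled by the third absolute moment of the deviation. -/
theorem abs_subgroupCollinearTriples_sub_le (l : (ZMod p)ˣ) (G : Subgroup (ZMod p)ˣ)
    (h : p ≤ Nat.card G ^ 2) :
    |(subgroupCollinearTriples l G : ℝ) - (Nat.card G : ℝ) ^ 6 / p| ≤
      20 * (Nat.card G : ℝ) ^ 4 + ∑ q, |lineError G q| ^ 3 := by
  classical
  have hp : (0 : ℝ) < p := Nat.cast_pos.2 (Fact.out : p.Prime).pos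
  have hp1 : (1 : ℝ) ≤ p := Nat.one_le_cast.2 (Fact.out : p.Prime).one_le
  obtain ⟨t, ht, hT⟩ := exists_subgroupCollinearTriples_eq l G
  have hsq := sum_lineError_sq_le G
  have hsq2 := sum_card_linePoints_sq_le G
  have hsum := sum_lineError G
  have hnp : (Nat.card G : ℝ) ≤ p := Nat.cast_le.2 (natCard_subgroup_le G)
  have hpn : (p : ℝ) ≤ (Nat.card G : ℝ) ^ 2 := by exact_mod_cast h
  set n : ℝ := (Nat.card G : ℝ) with hn
  have hn0 : 0 ≤ n := Nat.cast_nonneg _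
  set m : ℝ := n ^ 2 / p with hm
  have hm0 : 0 ≤ m := by positivity
  have hmp : m * p = n ^ 2 := by rw [hm]; field_simp
  set N : (ZMod p)ˣ × (ZMod p)ˣ → ℝ := fun q => ((linePoints G q).card : ℝ) with hN
  set s := lineShift l with hs
  have hN0 : ∀ q, 0 ≤ N q := fun q => Nat.cast_nonneg _
  have hNe : ∀ q, N q = m + lineError G q := by
    intro q; simp only [hN, lineError, hm]; ring
  have hTr : (subgroupCollinearTriples l G : ℝ) =
      t + ∑ q, ((linePairs G l q).card : ℝ) * N (s q) := by
    rw [hT]; push_cast; rfl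
  have ht' : (t : ℝ) ≤ n ^ 4 := by rw [hn]; exact_mod_cast ht
  have ht0 : (0 : ℝ) ≤ t := Nat.cast_nonneg _
  have hshift : ∀ f : (ZMod p)ˣ × (ZMod p)ˣ → ℝ, ∑ q, f (s q) = ∑ q, f q := sum_lineShift l
  -- passing from pairs of distinct points to all pairs of points
  have hN2 : ∑ q, N q ^ 2 ≤ 2 * n ^ 4 := by
    have h1 : ∑ q, N q ^ 2 ≤ n ^ 4 + n ^ 2 * ((p : ℝ) - 2) := by
      rw [← cast_prime_sub_two]
      simp only [hN, hn]
      exact_mod_cast hsq2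
    nlinarith [sq_nonneg n]
  have hupper : ∑ q, ((linePairs G l q).card : ℝ) * N (s q) ≤ ∑ q, N q * N (s q) ^ 2 := by
    refine Finset.sum_le_sum fun q _ => ?_
    have h1 : ((linePairs G l q).card : ℝ) ≤ N q * N (s q) := by
      simp only [hN]
      exact_mod_cast card_linePairs_le G l q
    have h2 := mul_le_mul_of_nonneg_right h1 (hN0 (s q))
    linarith
  have hlower : ∑ q, N q * N (s q) ^ 2 ≤
      ∑ q, ((linePairs G l q).card : ℝ) * N (s q) + 2 * n ^ 4 := by
    have h1 : ∀ q, N q * N (s q) ^ 2 ≤ ((linePairs G l q).card : ℝ) * N (s q) +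
        (N q ^ 2 + N (s q) ^ 2) / 2 := by
      intro q
      have h2 : N q * N (s q) ≤ ((linePairs G l q).card : ℝ) + N q := by
        simp only [hN]
        exact_mod_cast mul_card_le_card_linePairs_add G l q
      have h3 := mul_le_mul_of_nonneg_right h2 (hN0 (s q))
      nlinarith [sq_nonneg (N q - N (s q))]
    have h2 := Finset.sum_le_sum fun q (_ : q ∈ Finset.univ) => h1 q
    rw [Finset.sum_add_distrib, ← Finset.sum_div, Finset.sum_add_distrib,
      hshift fun q => N q ^ 2] at h2
    linarith
  -- expansion of the cubic sum around the expected value `m`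
  have hexp : ∑ q, N q * N (s q) ^ 2 = m ^ 3 * (p - 1) ^ 2 - 3 * m ^ 3 +
      m * ∑ q, (lineError G (s q) ^ 2 + 2 * (lineError G q * lineError G (s q))) +
      ∑ q, lineError G q * lineError G (s q) ^ 2 := by
    have h1 : ∀ q, N q * N (s q) ^ 2 = m ^ 3 + m ^ 2 * (lineError G q + 2 * lineError G (s q)) +
        m * (lineError G (s q) ^ 2 + 2 * (lineError G q * lineError G (s q))) +
        lineError G q * lineError G (s q) ^ 2 := by
      intro q
      rw [hNe, hNe]; ring
    simp only [h1, Finset.sum_add_distrib, ← Finset.mul_sum, Finset.sum_const, nsmul_eq_mul,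
      card_lines]
    rw [hshift fun q => lineError G q, hsum]
    ring
  have hquad1 : ∑ q, (lineError G (s q) ^ 2 + 2 * (lineError G q * lineError G (s q))) ≤
      12 * n ^ 2 * p := by
    have h1 : ∑ q, (lineError G (s q) ^ 2 + 2 * (lineError G q * lineError G (s q))) ≤
        ∑ q, (2 * lineError G (s q) ^ 2 + lineError G q ^ 2) := by
      refine Finset.sum_le_sum fun q _ => ?_
      nlinarith [sq_nonneg (lineError G q - lineError G (s q))]
    have h2 : ∑ q, (2 * lineError G (s q) ^ 2 + lineError G q ^ 2) =
        3 * ∑ q, lineError G q ^ 2 := by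
      rw [Finset.sum_add_distrib, ← Finset.mul_sum, hshift fun q => lineError G q ^ 2]
      ring
    linarith
  have hquad2 : -(4 * n ^ 2 * p) ≤
      ∑ q, (lineError G (s q) ^ 2 + 2 * (lineError G q * lineError G (s q))) := by
    have h1 : ∑ q, -(lineError G q ^ 2) ≤
        ∑ q, (lineError G (s q) ^ 2 + 2 * (lineError G q * lineError G (s q))) := by
      refine Finset.sum_le_sum fun q _ => ?_
      nlinarith [sq_nonneg (lineError G q + lineError G (s q))]
    rw [Finset.sum_neg_distrib] at h1
    linarith
  have hcubic : |∑ q, lineError G q * lineError G (s q) ^ 2| ≤ ∑ q, |lineError G q| ^ 3 := by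
    have h1 : ∀ q, |lineError G q * lineError G (s q) ^ 2| ≤
        (|lineError G q| ^ 3 + 2 * |lineError G (s q)| ^ 3) / 3 := by
      intro q
      rw [abs_mul, abs_pow]
      have ha := abs_nonneg (lineError G q)
      have hb := abs_nonneg (lineError G (s q))
      generalize |lineError G q| = a at *
      generalize |lineError G (s q)| = b at *
      nlinarith [mul_nonneg (add_nonneg ha (add_nonneg hb hb)) (sq_nonneg (a - b))]
    refine (Finset.abs_sum_le_sum_abs _ _).trans ?_
    have h2 := Finset.sum_le_sum fun q (_ : q ∈ Finset.univ) => h1 q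
    rw [← Finset.sum_div, Finset.sum_add_distrib, ← Finset.mul_sum,
      hshift fun q => |lineError G q| ^ 3] at h2
    linarith
  have hmain : n ^ 6 / p = m ^ 3 * p ^ 2 := by
    rw [hm]; field_simp
  have hmn : m ^ 3 * p ≤ n ^ 4 := by
    have h1 : m ≤ n := by
      rw [hm, div_le_iff₀ hp, sq]
      exact mul_le_mul_of_nonneg_left hnp hn0
    have h2 : m ^ 3 * p = m ^ 2 * n ^ 2 := by rw [← hmp]; ring
    have h3 : m ^ 2 ≤ n ^ 2 := pow_le_pow_left₀ hm0 h1 2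
    nlinarith [sq_nonneg n]
  have hm3 : 0 ≤ m ^ 3 := by positivity
  have hm3p : m ^ 3 ≤ m ^ 3 * p := le_mul_of_one_le_right hm3 hp1
  have hmq1 := mul_le_mul_of_nonneg_left hquad1 hm0
  have hmq2 := mul_le_mul_of_nonneg_left hquad2 hm0
  have e1 : m * (12 * n ^ 2 * p) = 12 * n ^ 4 := by
    have : m * (12 * n ^ 2 * p) = 12 * n ^ 2 * (m * p) := by ring
    rw [this, hmp]; ring
  have e2 : m * -(4 * n ^ 2 * p) = -(4 * n ^ 4) := by
    have : m * -(4 * n ^ 2 * p) = -(4 * n ^ 2 * (m * p)) := by ring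
    rw [this, hmp]; ring
  rw [e1] at hmq1
  rw [e2] at hmq2
  have hc := abs_le.1 hcubic
  have hn4 : 0 ≤ n ^ 4 := by positivity
  rw [hTr, hmain, abs_le]
  have e3 : m ^ 3 * ((p : ℝ) - 1) ^ 2 = m ^ 3 * p ^ 2 - 2 * (m ^ 3 * p) + m ^ 3 := by ring
  rw [e3] at hexp
  constructor <;> linarith [hc.1, hc.2]

/-- The third moment through the uniform bound for the deviation. -/
theorem sum_abs_lineError_pow_three_le (G : Subgroup (ZMod p)ˣ) :
    ∑ q, |lineError G q| ^ 3 ≤ 8 * ((Nat.card G : ℝ) ^ 2 * (p * Real.sqrt p)) := by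
  have h1 : ∀ q, |lineError G q| ^ 3 ≤ 2 * Real.sqrt p * lineError G q ^ 2 := by
    intro q
    have h2 : |lineError G q| ≤ 2 * Real.sqrt p := by
      refine abs_le_of_sq_le_sq ?_ (by positivity)
      rw [mul_pow, Real.sq_sqrt (Nat.cast_nonneg _)]
      linarith [lineError_sq_le G q]
    calc |lineError G q| ^ 3 = |lineError G q| * lineError G q ^ 2 := by
          rw [← sq_abs (lineError G q)]; ring
      _ ≤ _ := by gcongr
  refine (Finset.sum_le_sum fun q _ => h1 q).trans ?_
  rw [← Finset.mul_sum]
  calc 2 * Real.sqrt p * ∑ q, lineError G q ^ 2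
      ≤ 2 * Real.sqrt p * (4 * (Nat.card G : ℝ) ^ 2 * p) := by
        gcongr
        exact sum_lineError_sq_le G
    _ = _ := by ring

/-- The third moment through the bound for rich lines: on the remaining lines the deviation is
`O(|G| ^ 2 / p)`, and the mean square suffices. -/
theorem sum_abs_lineError_pow_three_le_log (G : Subgroup (ZMod p)ˣ) (h : p ≤ Nat.card G ^ 2) :
    ∑ q, |lineError G q| ^ 3 ≤
      2 ^ 19 * (Nat.card G : ℝ) ^ 4 * (1 + 2 * Real.log (Nat.card G)) := by
  classical
  have hp : (0 : ℝ) < p := Nat.cast_pos.2 (Fact.out : p.Prime).pos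
  set n := Nat.card G with hn
  have hm1 : (1 : ℝ) ≤ (n : ℝ) ^ 2 / p := by
    rw [le_div_iff₀ hp, one_mul]; exact_mod_cast h
  set m : ℝ := (n : ℝ) ^ 2 / p with hm
  set K : ℕ := ⌈256 * m⌉₊ with hK
  have hKm : 256 * m ≤ K := Nat.le_ceil _
  have hKm' : (K : ℝ) ≤ 257 * m := by
    have := Nat.ceil_lt_add_one (a := 256 * m) (by linarith)
    linarith
  have hK256 : 256 ≤ K := by
    have : (256 : ℝ) ≤ K := by linarith
    exact_mod_cast this
  have hKp : 256 * n ^ 2 ≤ p * K := by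
    have : (256 : ℝ) * n ^ 2 ≤ p * K := by
      calc (256 : ℝ) * n ^ 2 = p * (256 * m) := by rw [hm]; field_simp
        _ ≤ p * K := by gcongr
    exact_mod_cast this
  have hrich := sum_rich_lines_pow_three_le G hK256 hKp
  rw [Finset.sum_filter] at hrich
  have hpt : ∀ q, |lineError G q| ^ 3 ≤ 514 * m * lineError G q ^ 2 +
      if 2 * K ≤ (linePoints G q).card then ((linePoints G q).card : ℝ) ^ 3 else 0 := by
    intro q
    have hN0 : (0 : ℝ) ≤ (linePoints G q).card := Nat.cast_nonneg _
    have hle : lineError G q = (linePoints G q).card - m := rfl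
    split_ifs with hq
    · have hq' : (2 : ℝ) * K ≤ (linePoints G q).card := by exact_mod_cast hq
      have h1 : |lineError G q| ≤ (linePoints G q).card := by
        rw [hle, abs_le]; constructor <;> linarith
      have h2 := pow_le_pow_left₀ (abs_nonneg _) h1 3
      have h3 : 0 ≤ 514 * m * lineError G q ^ 2 := by positivity
      linarith
    · have hq' : ((linePoints G q).card : ℝ) ≤ 2 * K := by
        exact_mod_cast (by omega : (linePoints G q).card ≤ 2 * K)
      have h1 : |lineError G q| ≤ 514 * m := by
        rw [hle, abs_le]; constructor <;> linarith
      rw [add_zero]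
      calc |lineError G q| ^ 3 = |lineError G q| * lineError G q ^ 2 := by
            rw [← sq_abs (lineError G q)]; ring
        _ ≤ _ := by gcongr
  have hsum := Finset.sum_le_sum fun q (_ : q ∈ Finset.univ) => hpt q
  rw [Finset.sum_add_distrib, ← Finset.mul_sum] at hsum
  have h2 : 514 * m * ∑ q, lineError G q ^ 2 ≤ 514 * m * (4 * (n : ℝ) ^ 2 * p) := by
    gcongr
    exact sum_lineError_sq_le G
  have h3 : 514 * m * (4 * (n : ℝ) ^ 2 * p) = 2056 * (n : ℝ) ^ 4 := by
    rw [hm]; field_simp; ring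
  have hlog : 0 ≤ (n : ℝ) ^ 4 * Real.log n :=
    mul_nonneg (by positivity) (Real.log_natCast_nonneg _)
  have hn4 : (0 : ℝ) ≤ (n : ℝ) ^ 4 := by positivity
  nlinarith

/-- The asymptotic formula for the number of collinear triples with error `O(|G| ^ 4 log |G|)`,
without restriction on the size of `G`. -/
theorem abs_subgroupCollinearTriples_sub_le_log (l : (ZMod p)ˣ) (G : Subgroup (ZMod p)ˣ) :
    |(subgroupCollinearTriples l G : ℝ) - (Nat.card G : ℝ) ^ 6 / p| ≤
      2 ^ 21 * ((Nat.card G : ℝ) ^ 4 * (1 + 2 * Real.log (Nat.card G))) := by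
  have hp : (0 : ℝ) < p := Nat.cast_pos.2 (Fact.out : p.Prime).pos
  have hlog : 0 ≤ (Nat.card G : ℝ) ^ 4 * Real.log (Nat.card G) :=
    mul_nonneg (by positivity) (Real.log_natCast_nonneg _)
  have hn4 : (0 : ℝ) ≤ (Nat.card G : ℝ) ^ 4 := by positivity
  rcases le_total (Nat.card G ^ 2) p with h | h
  · have h1 := subgroupCollinearTriples_le_of_sq_le l G h
    have h2 : (Nat.card G : ℝ) ^ 6 / p ≤ (Nat.card G : ℝ) ^ 4 := by
      rw [div_le_iff₀ hp]
      have h3 : (Nat.card G : ℝ) ^ 2 ≤ p := by exact_mod_cast h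
      calc (Nat.card G : ℝ) ^ 6 = (Nat.card G : ℝ) ^ 4 * (Nat.card G : ℝ) ^ 2 := by ring
        _ ≤ _ := by gcongr
    have h3 : 0 ≤ (Nat.card G : ℝ) ^ 6 / p := by positivity
    have h4 : (0 : ℝ) ≤ subgroupCollinearTriples l G := Nat.cast_nonneg _
    rw [abs_le]
    constructor <;> nlinarith
  · have h1 := abs_subgroupCollinearTriples_sub_le l G h
    have h2 := sum_abs_lineError_pow_three_le_log G h
    nlinarith

end Lines

theorem theorem1p2 :
    ∃ C : ℝ, 0 < C ∧
      ∀ (p : ℕ) [Fact p.Prime] (G : Subgroup (ZMod p)ˣ) (l : (ZMod p)ˣ),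
        ((p : ℝ) ^ (2 / 3 : ℝ) ≤ (Nat.card G : ℝ) →
          |(subgroupCollinearTriples l G : ℝ) - (Nat.card G : ℝ) ^ 6 / (p : ℝ)|
            ≤ C * ((p : ℝ) ^ (1 / 2 : ℝ) * (Nat.card G : ℝ) ^ (7 / 2 : ℝ))) ∧
        ((Nat.card G : ℝ) < (p : ℝ) ^ (2 / 3 : ℝ) →
          (p : ℝ) ^ (1 / 2 : ℝ) * Real.log (p : ℝ) ≤ (Nat.card G : ℝ) →
          |(subgroupCollinearTriples l G : ℝ) - (Nat.card G : ℝ) ^ 6 / (p : ℝ)|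
            ≤ C * ((Nat.card G : ℝ) ^ 5 * (p : ℝ) ^ (-(1 / 2) : ℝ))) ∧
        (2 ≤ Nat.card G →
          (Nat.card G : ℝ) < (p : ℝ) ^ (1 / 2 : ℝ) * Real.log (p : ℝ) →
          |(subgroupCollinearTriples l G : ℝ) - (Nat.card G : ℝ) ^ 6 / (p : ℝ)|
            ≤ C * ((Nat.card G : ℝ) ^ 4 * Real.log (Nat.card G : ℝ))) := by
  refine ⟨2 ^ 23, by norm_num, fun p _ G l => ?_⟩
  have hp2 : (2 : ℝ) ≤ p := by exact_mod_cast (Fact.out : p.Prime).two_le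
  have hp : (0 : ℝ) < p := by linarith
  have hn1 : (1 : ℝ) ≤ Nat.card G := by exact_mod_cast natCard_subgroup_pos G
  have hnp : (Nat.card G : ℝ) ≤ p := Nat.cast_le.2 (natCard_subgroup_le G)
  have hlog2 := Real.log_two_gt_d9
  have hmain := abs_subgroupCollinearTriples_sub_le_log l G
  refine ⟨fun h => ?_, fun _ h => ?_, fun h _ => ?_⟩
  -- for `p ^ (2 / 3) ≤ |G|` the uniform bound for the deviation is the efficient one
  · have hn32 : (p : ℝ) ≤ (Nat.card G : ℝ) ^ (3 / 2 : ℝ) := by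
      have h1 := Real.rpow_le_rpow (by positivity) h (by norm_num : (0 : ℝ) ≤ 3 / 2)
      rw [← Real.rpow_mul hp.le] at h1
      norm_num at h1
      exact h1
    have hpn2 : p ≤ Nat.card G ^ 2 := by
      have h1 : (p : ℝ) ≤ (Nat.card G : ℝ) ^ 2 := by
        rw [← Real.rpow_natCast]
        exact hn32.trans (Real.rpow_le_rpow_of_exponent_le hn1 (by norm_num))
      exact_mod_cast h1
    have h1 := abs_subgroupCollinearTriples_sub_le l G hpn2
    have h2 := sum_abs_lineError_pow_three_le G
    rw [← Real.sqrt_eq_rpow]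
    set n : ℝ := (Nat.card G : ℝ) with hn
    have e1 : n ^ (7 / 2 : ℝ) = n ^ 2 * n ^ (3 / 2 : ℝ) := by
      rw [← Real.rpow_natCast, ← Real.rpow_add (by linarith)]; norm_num
    have e2 : n ^ (7 / 2 : ℝ) = n ^ 3 * Real.sqrt n := by
      rw [Real.sqrt_eq_rpow, ← Real.rpow_natCast, ← Real.rpow_add (by linarith)]; norm_num
    have h3 : n ^ 4 ≤ Real.sqrt p * n ^ (7 / 2 : ℝ) := by
      rw [e2]
      calc n ^ 4 = Real.sqrt n * (n ^ 3 * Real.sqrt n) := by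
            have := Real.mul_self_sqrt (by linarith : 0 ≤ n)
            calc n ^ 4 = n ^ 3 * n := by ring
              _ = n ^ 3 * (Real.sqrt n * Real.sqrt n) := by rw [this]
              _ = _ := by ring
        _ ≤ _ := by gcongr
    have h4 : n ^ 2 * (p * Real.sqrt p) ≤ Real.sqrt p * n ^ (7 / 2 : ℝ) := by
      rw [e1]
      calc n ^ 2 * (p * Real.sqrt p) = Real.sqrt p * (n ^ 2 * p) := by ring
        _ ≤ _ := by gcongr
    have h5 : 0 ≤ Real.sqrt p * n ^ (7 / 2 : ℝ) := by positivity
    linarith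
  · have hlogp : Real.log 2 ≤ Real.log p := Real.log_le_log (by norm_num) hp2
    have hlogn : Real.log (Nat.card G) ≤ Real.log p := Real.log_le_log (by linarith) hnp
    set n : ℝ := (Nat.card G : ℝ) with hn
    have h1 : Real.log p ≤ n * (p : ℝ) ^ (-(1 / 2) : ℝ) := by
      rw [Real.rpow_neg hp.le, ← div_eq_mul_inv, le_div_iff₀ (by positivity), mul_comm]
      exact h
    have h2 : 1 + 2 * Real.log n ≤ 4 * (n * (p : ℝ) ^ (-(1 / 2) : ℝ)) := by linarith
    calc _ ≤ _ := hmain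
      _ ≤ 2 ^ 21 * (n ^ 4 * (4 * (n * (p : ℝ) ^ (-(1 / 2) : ℝ)))) := by gcongr
      _ = _ := by ring
  · have h2 : (2 : ℝ) ≤ Nat.card G := by exact_mod_cast h
    have hlogn : Real.log 2 ≤ Real.log (Nat.card G) := Real.log_le_log (by norm_num) h2
    calc _ ≤ _ := hmain
      _ ≤ 2 ^ 21 * ((Nat.card G : ℝ) ^ 4 * (4 * Real.log (Nat.card G))) := by
          gcongr
          linarith
      _ = _ := by ring
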